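/- Let $\Omega\subset\mathbb{R}^2$ be the image domain, let $f,u:\Omega\to\mathbb{R}$ be smooth, and let $\nu(s)=1+|s|$ (the $L^1$ amoeba metric). For a regular curve $\gamma:[0,1]\to\Omega$, $\gamma=(x,y)$, put $L_\nu(\gamma)=\int_0^1\nu\bigl(\dot f/\sqrt{\dot x^2+\dot y^2}\bigr)\sqrt{\dot x^2+\dot y^2}\,\mathrm{d}t$ with $\dot f=\frac{\mathrm{d}}{\mathrm{d}t}f(\gamma(t))$; let $d(p,q)$ be the infimum of $L_\nu$ over all such curves from $p$ to $q$, and let $\mathcal{A}_\varrho(p)=\{q\in\Omega: d(p,q)\le\varrho\}$ be the amoeba of radius $\varrho>0$. Amoeba median filtering replaces $u(p)$ by the median (with respect to area) of $u$ on $\mathcal{A}_\varrho(p)$. For $s>0$ and $\alpha\in\mathbb{R}$ let $$J_k(s,\alpha)=\int_{\alpha-\pi/2}^{\alpha+\pi/2}\frac{\nu'(s\cos\vartheta)}{\nu(s\cos\vartheta)^4}\,w_k(\vartheta)\,\mathrm{d}\vartheta,\qquad w_1=\sin^2\vartheta,\quad w_2=\sin\vartheta\cos\vartheta,\quad w_3=\cos^2\vartheta,$$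 and for $s=0$, where $\nu'(0)$ does not exist, let $J_k(0,\alpha)=\lim_{s\to0^+}J_k(s,\alpha)$. (a) Let $x_0$ be an interior point of $\Omega$ with $\nabla f(x_0)\neq0$ and $\nabla u(x_0)\neq0$, let $\varphi$ and $\varphi+\alpha$ be direction angles of $\nabla f(x_0)$ and $\nabla u(x_0)$, and put $\chi=(\cos\varphi,\sin\varphi)$, $\zeta=(-\sin\varphi,\cos\varphi)$, $\xi=(-\sin(\varphi+\alpha),\cos(\varphi+\alpha))$. Then for all sufficiently small $\varrho>0$ a median of $u$ on $\mathcal{A}_\varrho(x_0)$ exists, and every such median $\mu_\varrho$ satisfies $$\mu_\varrho=u(x_0)+\frac{\varrho^2}{6}\Bigl(\frac{u_{\xi\xi}}{\nu(|\nabla f|\sin\alpha)^2}-\frac32\,\nu(|\nabla f|\sin\alpha)\,|\nabla u|\,\bigl(J_1f_{\zeta\zeta}+2J_2f_{\zeta\chi}+J_3f_{\chi\chi}\bigr)\Bigr)+\mathcal{O}(\varrho^3)\qquad(\varrho\to0),$$ where $J_k=J_k(|\nabla f|,\alpha)$ and all derivatives are taken at $x_0$. That is, one filtering step is asymptotically a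 time step of size $\varrho^2/6$ of the explicit time discretisation of the PDE $u_t=(\cdots)$ whose right-hand side is the large bracket. (b) For all $\alpha\in\mathbb{R}$ the coefficients are given as follows. For $s\ge0$, $$J_2=\frac{\sin\alpha\,|\sin\alpha|\,(3+s|\sin\alpha|)}{3(1+s|\sin\alpha|)^3}.$$ With $$R_1=\frac{\cos\alpha\,\bigl((2s^3+s)\sin^2\alpha+3(s^2+1)|\sin\alpha|-2s^3+5s\bigr)}{3(s^2-1)^2(1+s|\sin\alpha|)^3},$$ $$R_3=\frac{\cos\alpha\,\bigl(s(2s^2+13)+3(2s^4+9s^2-1)|\sin\alpha|+s(6s^4+10s^2-1)\sin^2\alpha\bigr)}{3(s^2-1)^3(1+s|\sin\alpha|)^3},$$ for $s>1$, $$J_1=\frac{\Lambda}{(s^2-1)^{5/2}}-R_1,\quad J_3=-\frac{(4s^2+1)\,\Lambda}{(s^2-1)^{7/2}}+R_3,\quad \Lambda=\ln\frac{\sqrt{s+1}(1+|\sin\alpha|)+\sqrt{s-1}\cos\alpha}{\sqrt{s+1}(1+|\sin\alpha|)-\sqrt{s-1}\cos\alpha};$$ for $s=1$, $$J_1=\frac{2\cos^3\alpha\,(4+|\sin\alpha|)}{15(1+|\sin\alpha|)^4},\qquad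 J_3=\frac{2\cos\alpha\,(8+32|\sin\alpha|+52\sin^2\alpha+13|\sin\alpha|^3)}{105(1+|\sin\alpha|)^4};$$ for $0\le s<1$, $$J_1=\frac{2T}{(1-s^2)^{5/2}}-R_1,\quad J_3=\frac{(8s^2+2)\,T}{(1-s^2)^{7/2}}+R_3,\quad T=\arctan\Bigl(\sqrt{\tfrac{1-s}{1+s}}\,\frac{\cos\alpha}{1+|\sin\alpha|}\Bigr).$$ -/

import Mathlib

open Real Set Filter Topology MeasureTheory
open scoped ENNReal ContDiff

noncomputable section

/-- The image plane with its Euclidean norm. -/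
abbrev Plane : Type := EuclideanSpace ℝ (Fin 2)

/-- The unit vector with direction angle `φ`. -/
def dirVec (φ : ℝ) : Plane := !₂[cos φ, sin φ]

/-- The function `ν` that generates the `L¹` amoeba metric. -/
def nuL1 (s : ℝ) : ℝ := 1 + |s|

/-- `γ : [0,1] → Ω` is (the planar projection of) a regular curve from `p` to `q`: it is
continuously differentiable, with nowhere vanishing velocity. The curve on the graph of `f` is
`t ↦ (γ t, f (γ t))`. -/
structure IsRegularCurve (Ω : Set Plane) (p q : Plane) (γ : ℝ → Plane) : Prop where
  contDiffOn : ContDiffOn ℝ 1 γ (Icc 0 1)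
  velocity_ne_zero : ∀ t ∈ Icc (0 : ℝ) 1, derivWithin γ (Icc 0 1) t ≠ 0
  mapsTo : MapsTo γ (Icc 0 1) Ω
  source : γ 0 = p
  target : γ 1 = q

/-- The amoeba length `∫₀¹ ν(ḟ / √(ẋ² + ẏ²)) √(ẋ² + ẏ²) dt` of the curve over `γ` on the graph
of `f`. -/
def amoebaLength (ν : ℝ → ℝ) (f : Plane → ℝ) (γ : ℝ → Plane) : ℝ :=
  ∫ t in (0 : ℝ)..1,
    ν (derivWithin (f ∘ γ) (Icc 0 1) t / ‖derivWithin γ (Icc 0 1) t‖)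
      * ‖derivWithin γ (Icc 0 1) t‖

/-- The amoeba distance: the infimum of the amoeba lengths of all regular curves in `Ω` from `p`
to `q` (it is `∞` if there is no such curve). -/
def amoebaDist (ν : ℝ → ℝ) (Ω : Set Plane) (f : Plane → ℝ) (p q : Plane) : ℝ≥0∞ :=
  ⨅ (γ : ℝ → Plane) (_ : IsRegularCurve Ω p q γ), ENNReal.ofReal (amoebaLength ν f γ)

/-- The amoeba (structuring element) of radius `ρ` around `p`. -/
def amoeba (ν : ℝ → ℝ) (Ω : Set Plane) (f : Plane → ℝ) (ρ : ℝ) (p : Plane) : Set Plane :=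
  {q | q ∈ Ω ∧ amoebaDist ν Ω f p q ≤ ENNReal.ofReal ρ}

/-- `m` is a median of the values of `u` on the set `A`, with respect to area. -/
def IsMedianOn (u : Plane → ℝ) (A : Set Plane) (m : ℝ) : Prop :=
  volume {x ∈ A | u x < m} ≤ volume A / 2 ∧ volume {x ∈ A | m < u x} ≤ volume A / 2

/-- The coefficient `J₁(s, α)` of the amoeba PDE generated by `ν`. -/
def amoebaJ1 (ν : ℝ → ℝ) (s α : ℝ) : ℝ :=
  ∫ θ in (α - π / 2)..(α + π / 2), deriv ν (s * cos θ) / ν (s * cos θ) ^ 4 * sin θ ^ 2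

/-- The coefficient `J₂(s, α)` of the amoeba PDE generated by `ν`. -/
def amoebaJ2 (ν : ℝ → ℝ) (s α : ℝ) : ℝ :=
  ∫ θ in (α - π / 2)..(α + π / 2), deriv ν (s * cos θ) / ν (s * cos θ) ^ 4 * (sin θ * cos θ)

/-- The coefficient `J₃(s, α)` of the amoeba PDE generated by `ν`. -/
def amoebaJ3 (ν : ℝ → ℝ) (s α : ℝ) : ℝ :=
  ∫ θ in (α - π / 2)..(α + π / 2), deriv ν (s * cos θ) / ν (s * cos θ) ^ 4 * cos θ ^ 2

/-- The second directional derivative `h_{vw}(x) = vᵀ D²h(x) w`. -/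
def secondDeriv (h : Plane → ℝ) (x v w : Plane) : ℝ :=
  fderiv ℝ (fderiv ℝ h) x v w

/-- The right-hand side at `x` of the amoeba PDE generated by `ν`, with coefficient functions
`J1`, `J2`, `J3`. Here `φ` is the direction angle of the gradient of `f` and `φ + α` that of the
gradient of `u`; thus `χ = dirVec φ`, `ζ = dirVec (φ + π / 2)` and `ξ = dirVec (φ + α + π / 2)`. -/
def amoebaPDERhs (ν : ℝ → ℝ) (J1 J2 J3 : ℝ → ℝ → ℝ) (f u : Plane → ℝ) (φ α : ℝ) (x : Plane) : ℝ :=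
  secondDeriv u x (dirVec (φ + α + π / 2)) (dirVec (φ + α + π / 2))
      / ν (‖gradient f x‖ * sin α) ^ 2
    - 3 / 2 * ν (‖gradient f x‖ * sin α) * ‖gradient u x‖ *
      (J1 ‖gradient f x‖ α * secondDeriv f x (dirVec (φ + π / 2)) (dirVec (φ + π / 2))
        + 2 * J2 ‖gradient f x‖ α * secondDeriv f x (dirVec (φ + π / 2)) (dirVec φ)
        + J3 ‖gradient f x‖ α * secondDeriv f x (dirVec φ) (dirVec φ))

/-- The logarithm that occurs in the closed forms for `1 < s`. -/
def logTerm (s α : ℝ) : ℝ :=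
  log ((√(s + 1) * (1 + |sin α|) + √(s - 1) * cos α)
    / (√(s + 1) * (1 + |sin α|) - √(s - 1) * cos α))

/-- The arctangent that occurs in the closed forms for `0 ≤ s < 1`. -/
def arctanTerm (s α : ℝ) : ℝ :=
  arctan (√((1 - s) / (1 + s)) * (cos α / (1 + |sin α|)))

/-- The rational term in the closed form of `J₁` for `s ≠ 1`. -/
def ratTerm1 (s α : ℝ) : ℝ :=
  cos α * ((2 * s ^ 3 + s) * sin α ^ 2 + 3 * (s ^ 2 + 1) * |sin α| - 2 * s ^ 3 + 5 * s)
    / (3 * (s ^ 2 - 1) ^ 2 * (1 + s * |sin α|) ^ 3)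

/-- The rational term in the closed form of `J₃` for `s ≠ 1`. -/
def ratTerm3 (s α : ℝ) : ℝ :=
  cos α * (s * (2 * s ^ 2 + 13) + 3 * (2 * s ^ 4 + 9 * s ^ 2 - 1) * |sin α|
      + s * (6 * s ^ 4 + 10 * s ^ 2 - 1) * sin α ^ 2)
    / (3 * (s ^ 2 - 1) ^ 3 * (1 + s * |sin α|) ^ 3)

/-- Closed form of `J₁` for the `L¹` amoeba metric. -/
def closedJ1 (s α : ℝ) : ℝ :=
  if 1 < s then
    1 / (s ^ 2 - 1) ^ (5 / 2 : ℝ) * logTerm s α - ratTerm1 s α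
  else if s = 1 then
    2 * cos α ^ 3 * (4 + |sin α|) / (15 * (1 + |sin α|) ^ 4)
  else
    2 / (1 - s ^ 2) ^ (5 / 2 : ℝ) * arctanTerm s α - ratTerm1 s α

/-- Closed form of `J₂` for the `L¹` amoeba metric. -/
def closedJ2 (s α : ℝ) : ℝ :=
  sin α * |sin α| * (3 + s * |sin α|) / (3 * (1 + s * |sin α|) ^ 3)

/-- Closed form of `J₃` for the `L¹` amoeba metric. -/
def closedJ3 (s α : ℝ) : ℝ :=
  if 1 < s then
    -(4 * s ^ 2 + 1) / (s ^ 2 - 1) ^ (7 / 2 : ℝ) * logTerm s α + ratTerm3 s α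
  else if s = 1 then
    2 * cos α * (8 + 32 * |sin α| + 52 * sin α ^ 2 + 13 * |sin α| ^ 3)
      / (105 * (1 + |sin α|) ^ 4)
  else
    (8 * s ^ 2 + 2) / (1 - s ^ 2) ^ (7 / 2 : ℝ) * arctanTerm s α + ratTerm3 s α

end

/-! Since ν(s) = 1 + |s|, the amoeba length of a curve is its Euclidean length plus the total
variation of `f` along it. Every point x₀ + v of the amoeba therefore satisfies ‖v‖ + |f(x₀ + v) −
f(x₀)| ≤ ρ. Conversely, the segment from x₀ attains this bound whenever `f` is monotone along it,
which can fail only in a thin double cone around the level line of `f` (`mem_amoeba_or`). Up to a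
defect of higher order, the amoeba is thus an explicit set.

Rescale by ρ and use a complex coordinate z whose imaginary axis points along ∇u. The explicit set
becomes ‖z‖ + |F z| ≤ 1, where F is a linear form plus ρ times a quadratic form `h`, up to O(ρ²).
The level u(x₀) + ρ²k becomes the zero set of V = |∇u| Im z + ρ(b(z) − k) + O(ρ²). A median nearly
balances the areas of V > 0 and V < 0, so the core is the expansion of this balance to first order
in ρ (`exists_area_balance_le`). Two effects enter: the asymmetry of the amoeba (`shapeModel`), and
the bending and displacement of the level line (`levelModel`). Off a set of area O(ρ²) the sign of V
on the amoeba is the sum of these two models (`signOnAmoeba_eq`), and both have integrals exactly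
linear in ρ (`integral_shapeModel`, `integral_levelModel_quadratic`). The balance is cρ(k₀ − k) +
O(ρ²) with c > 0 and k₀ one sixth of the right-hand side of the PDE, so k = k₀ + O(ρ) at any median.

For the closed forms, the integrand is π-antiperiodic and the window is half a period of length 2π.
The coefficient is then antiperiodic in α, with derivative −2 times the integrand at the left end of
the window. It suffices to differentiate the closed form on [0, π], where |sin| = sin;
antiperiodicity fixes the constant of integration. The values at s = 0 follow by continuity. -/

/-! ### Closed forms of the coefficients. -/

theorem deriv_nuL1 (x : ℝ) : deriv nuL1 x = SignType.sign x := by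
  rw [← deriv_abs x]
  exact deriv_const_add 1

/-- The integrand shared by the coefficients `J₁`, `J₂`, `J₃` is antiperiodic. -/
theorem antiperiodic_amoebaIntegrand (s : ℝ) {w : ℝ → ℝ} (hw : Function.Periodic w π) :
    Function.Antiperiodic
      (fun θ => deriv nuL1 (s * cos θ) / nuL1 (s * cos θ) ^ 4 * w θ) π := by
  intro θ
  simp only [hw θ, cos_add_pi, deriv_nuL1, nuL1, mul_neg, abs_neg, Left.sign_neg,
    SignType.coe_neg]
  ring

theorem antiperiodic_integral_window {g : ℝ → ℝ} (hg : Function.Antiperiodic g π) :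
    Function.Antiperiodic (fun α => ∫ θ in (α - π / 2)..(α + π / 2), g θ) π := by
  intro α
  have h := intervalIntegral.integral_comp_add_right (a := α - π / 2) (b := α + π / 2) g π
  simp only [hg _, intervalIntegral.integral_neg] at h
  dsimp only
  rw [show α + π - π / 2 = α - π / 2 + π by ring, show α + π + π / 2 = α + π / 2 + π by ring]
  exact h.symm

/-- The difference is only antiperiodic, but its absolute value is periodic, so every point can be
moved into [0, π). -/
theorem eq_of_antiperiodic {f g : ℝ → ℝ} (hf : Function.Antiperiodic f π)
    (hg : Function.Antiperiodic g π) (h : ∀ x ∈ Icc 0 π, f x = g x) (x : ℝ) : f x = g x := by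
  have hp : Function.Periodic (fun x => |f x - g x|) π := by
    intro x
    simp only [hf x, hg x]
    rw [← abs_neg]
    congr 1
    ring
  obtain ⟨y, hy, hxy⟩ := hp.exists_mem_Ico₀ pi_pos x
  have : |f x - g x| = 0 := by
    have h' : |f x - g x| = |f y - g y| := hxy
    rw [h', h y ⟨hy.1, hy.2.le⟩]
    simp
  exact sub_eq_zero.1 (abs_eq_zero.1 this)

/-- On `[0, π]` the coefficient with weight `w` is any function `C` with the right derivative and
the right sum of boundary values. -/
theorem integral_window_eq {s : ℝ} (hs : 0 < s) {w C : ℝ → ℝ} (hw : Function.Periodic w π)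
    (hwc : Continuous w)
    (hC : ∀ β ∈ Icc 0 π, HasDerivAt C (-2 * w (β - π / 2) / (1 + s * sin β) ^ 4) β)
    (h0 : C 0 + C π = 0) {α : ℝ} (hα : α ∈ Icc 0 π) :
    ∫ θ in (α - π / 2)..(α + π / 2), deriv nuL1 (s * cos θ) / nuL1 (s * cos θ) ^ 4 * w θ
      = C α := by
  set g : ℝ → ℝ := fun θ => deriv nuL1 (s * cos θ) / nuL1 (s * cos θ) ^ 4 * w θ with hg
  have hanti := antiperiodic_amoebaIntegrand s hw
  set k : ℝ → ℝ := fun β => -2 * w (β - π / 2) / (1 + s * sin β) ^ 4 with hk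
  have hpos : ∀ β ∈ Icc 0 π, 0 < 1 + s * sin β := fun β hβ => by
    have := mul_nonneg hs.le (sin_nonneg_of_mem_Icc hβ)
    linarith
  have hkc : ContinuousOn k (Icc 0 π) := by
    apply ContinuousOn.div
    · fun_prop
    · fun_prop
    · intro β hβ
      exact (pow_pos (hpos β hβ) 4).ne'
  -- Only the open interval works: at 0 and π the sign factor vanishes while `k` need not. The
  -- endpoints form a null set.
  have hgk : ∀ β ∈ Ioo 0 π, g (β - π / 2) = -(1 / 2) * k β := by
    intro β hβ
    have hp : 0 < s * sin β := mul_pos hs (sin_pos_of_mem_Ioo hβ)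
    simp only [hg, hk, cos_sub_pi_div_two, deriv_nuL1, nuL1, sign_pos hp, abs_of_pos hp,
      SignType.coe_one]
    ring
  have key : ∀ a b, 0 ≤ a → a ≤ b → b ≤ π →
      IntervalIntegrable (fun β => g (β - π / 2)) volume a b ∧
      ∫ β in a..b, g (β - π / 2) = -(1 / 2) * (C b - C a) := by
    intro a b ha hab hb
    have hsub : uIcc a b ⊆ Icc 0 π := by
      rw [uIcc_of_le hab]
      exact Icc_subset_Icc ha hb
    have hi : IntervalIntegrable k volume a b := (hkc.mono hsub).intervalIntegrable
    have heq : ∀ x ∈ Ioo a b, g (x - π / 2) = -(1 / 2) * k x := fun x hx =>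
      hgk x ⟨ha.trans_lt hx.1, hx.2.trans_le hb⟩
    constructor
    · refine IntervalIntegrable.congr_ae (hi.const_mul (-(1 / 2))) ?_
      rw [uIoc_of_le hab, ← restrict_Ioo_eq_restrict_Ioc]
      exact (ae_restrict_mem measurableSet_Ioo).mono fun x hx => (heq x hx).symm
    · rw [intervalIntegral.integral_of_le hab, integral_Ioc_eq_integral_Ioo,
        setIntegral_congr_fun measurableSet_Ioo heq, ← integral_Ioc_eq_integral_Ioo,
        ← intervalIntegral.integral_of_le hab, intervalIntegral.integral_const_mul,
        intervalIntegral.integral_eq_sub_of_hasDerivAt (fun x hx => hC x (hsub hx)) hi]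
  obtain ⟨hi1, he1⟩ := key α π hα.1 hα.2 le_rfl
  obtain ⟨hi2, he2⟩ := key 0 α le_rfl hα.1 hα.2
  -- The part of the window beyond π folds back to [0, α] with reversed sign. The sum is C α − (C 0
  -- + C π) / 2, and `h0` removes the boundary values.
  have hshift : ∀ β, g (β + π - π / 2) = -g (β - π / 2) := fun β => by
    rw [show β + π - π / 2 = β - π / 2 + π by ring]
    exact hanti _
  have hi3 : IntervalIntegrable (fun β => g (β - π / 2)) volume (0 + π) (α + π) := by
    rw [← IntervalIntegrable.comp_add_right_iff (c := π)]
    simp only [hshift]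
    simpa [Pi.neg_def] using hi2.neg
  have he3 : ∫ β in (0 + π)..(α + π), g (β - π / 2) = (1 / 2) * (C α - C 0) := by
    rw [← intervalIntegral.integral_comp_add_right (fun β => g (β - π / 2)) π]
    simp only [hshift, intervalIntegral.integral_neg, he2]
    ring
  have hall : ∫ θ in (α - π / 2)..(α + π / 2), g θ = ∫ β in α..(α + π), g (β - π / 2) := by
    rw [intervalIntegral.integral_comp_sub_right]
    congr 1
    ring
  rw [zero_add] at hi3 he3
  rw [hall, ← intervalIntegral.integral_add_adjacent_intervals hi1 hi3, he1, he3]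
  linarith

/-- Hermite reduction: the rational term produces the fourth-power denominator. What is left over is
a multiple of 1 / (1 + s sin β), to be cancelled by the logarithm or the arctangent. -/
theorem hasDerivAt_ratTerm1_sin {s β : ℝ} (hs : s ^ 2 - 1 ≠ 0) (h : 1 + s * sin β ≠ 0) :
    HasDerivAt (fun β => cos β * ((2 * s ^ 3 + s) * sin β ^ 2 + 3 * (s ^ 2 + 1) * sin β
        - 2 * s ^ 3 + 5 * s) / (3 * (s ^ 2 - 1) ^ 2 * (1 + s * sin β) ^ 3))
      (2 * cos β ^ 2 / (1 + s * sin β) ^ 4 - 1 / ((s ^ 2 - 1) ^ 2 * (1 + s * sin β))) β := by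
  have hS := hasDerivAt_sin β
  have hc := hasDerivAt_cos β
  have := (hc.mul ((((hS.pow 2).const_mul (2 * s ^ 3 + s)).add
    (hS.const_mul (3 * (s ^ 2 + 1)))).sub_const (2 * s ^ 3) |>.add_const (5 * s))).div
    (((hS.const_mul s).const_add 1 |>.pow 3).const_mul (3 * (s ^ 2 - 1) ^ 2))
    (mul_ne_zero (mul_ne_zero three_ne_zero (pow_ne_zero 2 hs)) (pow_ne_zero 3 h))
  refine this.congr_deriv ?_
  simp only [Pi.add_apply, Pi.mul_apply, Pi.pow_apply]
  have h2 : cos β ^ 2 = 1 - sin β ^ 2 := by rw [← sin_sq_add_cos_sq β]; ring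
  clear this hS hc
  generalize sin β = x at *
  generalize cos β = c at *
  simp only [Nat.add_one_sub_one, Nat.cast_ofNat, pow_one]
  -- Opaque names for the two denominator factors let them be cleared as atoms; after cos² = 1 −
  -- sin² a polynomial identity remains.
  obtain ⟨D, hD⟩ : ∃ D, D = 1 + s * x := ⟨_, rfl⟩
  obtain ⟨q, hq⟩ : ∃ q, q = s ^ 2 - 1 := ⟨_, rfl⟩
  rw [← hD] at h ⊢
  rw [← hq] at hs ⊢
  field_simp
  rw [h2, hD, hq]
  ring

theorem hasDerivAt_ratTerm3_sin {s β : ℝ} (hs : s ^ 2 - 1 ≠ 0) (h : 1 + s * sin β ≠ 0) :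
    HasDerivAt (fun β => cos β * (s * (2 * s ^ 2 + 13) + 3 * (2 * s ^ 4 + 9 * s ^ 2 - 1) * sin β
        + s * (6 * s ^ 4 + 10 * s ^ 2 - 1) * sin β ^ 2)
        / (3 * (s ^ 2 - 1) ^ 3 * (1 + s * sin β) ^ 3))
      (-2 * sin β ^ 2 / (1 + s * sin β) ^ 4
        - (4 * s ^ 2 + 1) / ((s ^ 2 - 1) ^ 3 * (1 + s * sin β))) β := by
  have hS := hasDerivAt_sin β
  have hc := hasDerivAt_cos β
  have := (hc.mul (((hS.const_mul (3 * (2 * s ^ 4 + 9 * s ^ 2 - 1))).const_add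
    (s * (2 * s ^ 2 + 13))).add ((hS.pow 2).const_mul (s * (6 * s ^ 4 + 10 * s ^ 2 - 1))))).div
    (((hS.const_mul s).const_add 1 |>.pow 3).const_mul (3 * (s ^ 2 - 1) ^ 3))
    (mul_ne_zero (mul_ne_zero three_ne_zero (pow_ne_zero 3 hs)) (pow_ne_zero 3 h))
  refine this.congr_deriv ?_
  simp only [Pi.add_apply, Pi.mul_apply, Pi.pow_apply]
  have h2 : cos β ^ 2 = 1 - sin β ^ 2 := by rw [← sin_sq_add_cos_sq β]; ring
  clear this hS hc
  generalize sin β = x at *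
  generalize cos β = c at *
  simp only [Nat.add_one_sub_one, Nat.cast_ofNat, pow_one]
  obtain ⟨D, hD⟩ : ∃ D, D = 1 + s * x := ⟨_, rfl⟩
  obtain ⟨q, hq⟩ : ∃ q, q = s ^ 2 - 1 := ⟨_, rfl⟩
  rw [← hD] at h ⊢
  rw [← hq] at hs ⊢
  field_simp
  rw [h2, hD, hq]
  ring

/-- The product of numerator and denominator inside the logarithm is 2(1 + sin β)(1 + s sin β). The
numerator of the logarithmic derivative is also a multiple of 1 + sin β, so this factor cancels. -/
theorem hasDerivAt_logTerm_sin {s β : ℝ} (hs : 1 < s) (hβ : 0 ≤ sin β) :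
    HasDerivAt (fun β => log ((√(s + 1) * (1 + sin β) + √(s - 1) * cos β)
        / (√(s + 1) * (1 + sin β) - √(s - 1) * cos β)))
      (-√(s ^ 2 - 1) / (1 + s * sin β)) β := by
  have hS := hasDerivAt_sin β
  have hc := hasDerivAt_cos β
  have hp : √(s + 1) ^ 2 = s + 1 := sq_sqrt (by linarith)
  have hq : √(s - 1) ^ 2 = s - 1 := sq_sqrt (by linarith)
  have hpq : √(s ^ 2 - 1) = √(s + 1) * √(s - 1) := by
    rw [← sqrt_mul (by linarith)]; ring_nf
  have hlt : √(s - 1) < √(s + 1) := sqrt_lt_sqrt (by linarith) (by linarith)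
  have hq0 : 0 ≤ √(s - 1) := sqrt_nonneg _
  set p := √(s + 1)
  set q := √(s - 1)
  have hs1 : s = p ^ 2 - 1 := by linarith
  have hq1 : q ^ 2 = p ^ 2 - 2 := by linarith
  have h2 : cos β ^ 2 = 1 - sin β ^ 2 := by rw [← sin_sq_add_cos_sq β]; ring
  have hc1 := cos_le_one β
  have hc2 := neg_one_le_cos β
  have hA : 0 < p * (1 + sin β) + q * cos β := by nlinarith [mul_nonneg (hq0.trans hlt.le) hβ]
  have hB : 0 < p * (1 + sin β) - q * cos β := by nlinarith [mul_nonneg (hq0.trans hlt.le) hβ]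
  have hd : 0 < 1 + s * sin β := by nlinarith [mul_nonneg (by linarith : (0 : ℝ) ≤ s) hβ]
  have := ((((hS.const_add 1).const_mul p).add (hc.const_mul q)).div
    (((hS.const_add 1).const_mul p).sub (hc.const_mul q)) hB.ne').log (div_pos hA hB).ne'
  refine this.congr_deriv ?_
  simp only [Pi.add_apply, Pi.div_apply, Pi.sub_apply]
  have hA' := hA.ne'
  have hB' := hB.ne'
  have hd' := hd.ne'
  have e : (p * (1 + sin β) + q * cos β) * (p * (1 + sin β) - q * cos β)
      = 2 * (1 + sin β) * (1 + s * sin β) := by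
    have : (p * (1 + sin β) + q * cos β) * (p * (1 + sin β) - q * cos β)
      = p ^ 2 * (1 + sin β) ^ 2 - q ^ 2 * cos β ^ 2 := by ring
    rw [this, h2, hp, hq]
    ring
  have e2 : ((p * cos β + q * -sin β) * (p * (1 + sin β) - q * cos β)
      - (p * (1 + sin β) + q * cos β) * (p * cos β - q * -sin β)) = -2 * p * q * (1 + sin β) := by
    linear_combination (-2 * p * q) * sin_sq_add_cos_sq β
  have h1 : 1 + sin β ≠ 0 := by linarith
  calc _ = ((p * cos β + q * -sin β) * (p * (1 + sin β) - q * cos β)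
      - (p * (1 + sin β) + q * cos β) * (p * cos β - q * -sin β))
      / ((p * (1 + sin β) + q * cos β) * (p * (1 + sin β) - q * cos β)) := by field_simp
    _ = _ := by
      rw [e, e2, hpq]
      field_simp

/-- Half-angle substitution: cos β / (1 + sin β) = tan(π/4 − β/2). -/
theorem hasDerivAt_arctanTerm_sin {s β : ℝ} (hs0 : 0 ≤ s) (hs : s < 1) (hβ : 0 ≤ sin β) :
    HasDerivAt (fun β => arctan (√((1 - s) / (1 + s)) * (cos β / (1 + sin β))))
      (-√(1 - s ^ 2) / (2 * (1 + s * sin β))) β := by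
  have hS := hasDerivAt_sin β
  have hc := hasDerivAt_cos β
  have h1 : 0 < 1 + sin β := by linarith
  have h2 : cos β ^ 2 = 1 - sin β ^ 2 := by rw [← sin_sq_add_cos_sq β]; ring
  have hd : 0 < 1 + s * sin β := by nlinarith [mul_nonneg hs0 hβ]
  have hκ : √((1 - s) / (1 + s)) ^ 2 = (1 - s) / (1 + s) :=
    sq_sqrt (div_nonneg (by linarith) (by linarith))
  have hκ' : √(1 - s ^ 2) = √((1 - s) / (1 + s)) * (1 + s) := by
    rw [show 1 - s ^ 2 = (1 - s) / (1 + s) * (1 + s) ^ 2 by field_simp; ring,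
      sqrt_mul (div_nonneg (by linarith) (by linarith)), sqrt_sq (by linarith)]
  have := ((hc.div (hS.const_add 1) h1.ne').const_mul (√((1 - s) / (1 + s)))).arctan
  refine this.congr_deriv ?_
  rw [hκ']
  simp only [Pi.div_apply, mul_pow, hκ, div_pow, h2]
  have e : 1 + (1 - s) / (1 + s) * ((1 - sin β ^ 2) / (1 + sin β) ^ 2)
      = 2 * (1 + s * sin β) / ((1 + s) * (1 + sin β)) := by
    field_simp
    ring
  have e2 : (-sin β * (1 + sin β) - cos β * cos β) / (1 + sin β) ^ 2 = -1 / (1 + sin β) := by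
    rw [← pow_two (cos β), h2]
    field_simp
    ring
  rw [e, e2]
  field_simp

theorem rpow_five_halves {x : ℝ} (hx : 0 < x) : x ^ (5 / 2 : ℝ) = x ^ 2 * √x := by
  rw [show (5 / 2 : ℝ) = (2 : ℕ) + 1 / 2 by norm_num, rpow_add hx, rpow_natCast, sqrt_eq_rpow]

theorem rpow_seven_halves {x : ℝ} (hx : 0 < x) : x ^ (7 / 2 : ℝ) = x ^ 3 * √x := by
  rw [show (7 / 2 : ℝ) = (3 : ℕ) + 1 / 2 by norm_num, rpow_add hx, rpow_natCast, sqrt_eq_rpow]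

theorem antiperiodic_logTerm (s : ℝ) : Function.Antiperiodic (logTerm s) π := by
  intro α
  simp only [logTerm, sin_add_pi, cos_add_pi, abs_neg]
  rw [← log_inv, inv_div]
  congr 2 <;> ring

theorem antiperiodic_arctanTerm (s : ℝ) : Function.Antiperiodic (arctanTerm s) π := by
  intro α
  simp only [arctanTerm, sin_add_pi, cos_add_pi, abs_neg]
  rw [← arctan_neg]
  congr 1
  ring

theorem antiperiodic_ratTerm1 (s : ℝ) : Function.Antiperiodic (ratTerm1 s) π := by
  intro α
  simp only [ratTerm1, sin_add_pi, cos_add_pi, abs_neg]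
  ring

theorem antiperiodic_ratTerm3 (s : ℝ) : Function.Antiperiodic (ratTerm3 s) π := by
  intro α
  simp only [ratTerm3, sin_add_pi, cos_add_pi, abs_neg]
  ring

theorem antiperiodic_closedJ1 (s : ℝ) : Function.Antiperiodic (closedJ1 s) π := by
  intro α
  simp only [closedJ1, antiperiodic_logTerm s α, antiperiodic_arctanTerm s α,
    antiperiodic_ratTerm1 s α, sin_add_pi, cos_add_pi, abs_neg]
  split_ifs <;> ring

theorem antiperiodic_closedJ2 (s : ℝ) : Function.Antiperiodic (closedJ2 s) π := by
  intro α
  simp only [closedJ2, sin_add_pi, abs_neg]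
  ring

theorem antiperiodic_closedJ3 (s : ℝ) : Function.Antiperiodic (closedJ3 s) π := by
  intro α
  simp only [closedJ3, antiperiodic_logTerm s α, antiperiodic_arctanTerm s α,
    antiperiodic_ratTerm3 s α, sin_add_pi, cos_add_pi, abs_neg]
  split_ifs <;> ring

/-- A closed form that is antiperiodic, and on `[0, π]` agrees with a function `C` with the right
derivative, is the coefficient with weight `w`. -/
theorem integral_window_eq_closed {s : ℝ} (hs : 0 < s) {w C D : ℝ → ℝ}
    (hw : Function.Periodic w π) (hwc : Continuous w)
    (hC : ∀ β ∈ Icc 0 π, HasDerivAt C (-2 * w (β - π / 2) / (1 + s * sin β) ^ 4) β)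
    (hD : Function.Antiperiodic D π) (hCD : ∀ β ∈ Icc 0 π, D β = C β) (α : ℝ) :
    ∫ θ in (α - π / 2)..(α + π / 2), deriv nuL1 (s * cos θ) / nuL1 (s * cos θ) ^ 4 * w θ
      = D α := by
  refine eq_of_antiperiodic (antiperiodic_integral_window (antiperiodic_amoebaIntegrand s hw)) hD
    (fun β hβ => ?_) α
  rw [hCD β hβ]
  refine integral_window_eq hs hw hwc hC ?_ hβ
  rw [← hCD 0 ⟨le_rfl, pi_pos.le⟩, ← hCD π ⟨pi_pos.le, le_rfl⟩]
  have := hD 0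
  rw [zero_add] at this
  rw [this, add_neg_cancel]

theorem amoebaJ2_eq_closedJ2 {s : ℝ} (hs : 0 < s) (α : ℝ) :
    amoebaJ2 nuL1 s α = closedJ2 s α := by
  refine integral_window_eq_closed (C := fun β => sin β * sin β * (3 + s * sin β)
    / (3 * (1 + s * sin β) ^ 3)) hs (fun θ => by simp) (by fun_prop) (fun β hβ => ?_)
    (antiperiodic_closedJ2 s) (fun β hβ => ?_) α
  · have hd : 1 + s * sin β ≠ 0 := by
      have := mul_nonneg hs.le (sin_nonneg_of_mem_Icc hβ)
      linarith
    have hS := hasDerivAt_sin β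
    have := ((hS.mul hS).mul ((hS.const_mul s).const_add 3)).div
      (((hS.const_mul s).const_add 1 |>.pow 3).const_mul 3)
      (mul_ne_zero three_ne_zero (pow_ne_zero 3 hd))
    refine this.congr_deriv ?_
    simp only [Pi.mul_apply, Pi.pow_apply, sin_sub_pi_div_two, cos_sub_pi_div_two]
    clear this hS
    generalize sin β = x at *
    generalize cos β = c at *
    simp only [Nat.add_one_sub_one, Nat.cast_ofNat]
    field_simp
    ring
  · rw [closedJ2, abs_of_nonneg (sin_nonneg_of_mem_Icc hβ)]

/-- For s ≠ 1 the coefficient of the transcendental term is the one that cancels the leftover from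
`hasDerivAt_ratTerm1_sin`. At s = 1 the factor s² − 1 degenerates, but the antiderivative is then
purely rational in sin and cos. -/
theorem amoebaJ1_eq_closedJ1 {s : ℝ} (hs : 0 < s) (α : ℝ) :
    amoebaJ1 nuL1 s α = closedJ1 s α := by
  have hper : Function.Periodic (fun θ => sin θ ^ 2) π := fun θ => by simp
  have hd : ∀ β ∈ Icc 0 π, 1 + s * sin β ≠ 0 := fun β hβ => by
    have := mul_nonneg hs.le (sin_nonneg_of_mem_Icc hβ)
    linarith
  rcases lt_trichotomy s 1 with h | h | h
  · have h1 : 0 < 1 - s ^ 2 := by nlinarith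
    refine integral_window_eq_closed hs hper (by fun_prop)
      (C := fun β => 2 / (1 - s ^ 2) ^ (5 / 2 : ℝ)
        * arctan (√((1 - s) / (1 + s)) * (cos β / (1 + sin β)))
        - cos β * ((2 * s ^ 3 + s) * sin β ^ 2 + 3 * (s ^ 2 + 1) * sin β
        - 2 * s ^ 3 + 5 * s) / (3 * (s ^ 2 - 1) ^ 2 * (1 + s * sin β) ^ 3))
      (fun β hβ => ?_) (antiperiodic_closedJ1 s) (fun β hβ => ?_) α
    · have h0 := sin_nonneg_of_mem_Icc hβ
      refine (((hasDerivAt_arctanTerm_sin hs.le h h0).const_mul _).sub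
        (hasDerivAt_ratTerm1_sin (by linarith) (hd β hβ))).congr_deriv ?_
      have hr : √(1 - s ^ 2) ≠ 0 := (sqrt_pos.2 h1).ne'
      have := hd β hβ
      rw [rpow_five_halves h1, sin_sub_pi_div_two]
      have e : s ^ 2 - 1 = -(1 - s ^ 2) := by ring
      rw [e]
      field_simp
      ring
    · rw [closedJ1, if_neg h.le.not_gt, if_neg h.ne, arctanTerm, ratTerm1,
        abs_of_nonneg (sin_nonneg_of_mem_Icc hβ)]
  · subst h
    refine integral_window_eq_closed hs hper (by fun_prop)
      (C := fun β => 2 * cos β ^ 3 * (4 + sin β) / (15 * (1 + sin β) ^ 4))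
      (fun β hβ => ?_) (antiperiodic_closedJ1 1) (fun β hβ => ?_) α
    · have hS := hasDerivAt_sin β
      have hc := hasDerivAt_cos β
      have hd' := hd β hβ
      have h2 : cos β ^ 2 = 1 - sin β ^ 2 := by rw [← sin_sq_add_cos_sq β]; ring
      rw [one_mul] at *
      refine ((((hc.pow 3).const_mul 2).mul (hS.const_add 4)).div
        ((hS.const_add 1 |>.pow 4).const_mul 15)
        (mul_ne_zero (by norm_num) (pow_ne_zero 4 hd'))).congr_deriv ?_
      simp only [Pi.mul_apply, Pi.pow_apply, sin_sub_pi_div_two]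
      clear hS hc hd
      generalize sin β = x at *
      generalize cos β = c at *
      simp only [Nat.add_one_sub_one, Nat.cast_ofNat]
      field_simp
      rw [h2]
      ring
    · rw [closedJ1, if_neg (lt_irrefl _), if_pos rfl, abs_of_nonneg (sin_nonneg_of_mem_Icc hβ)]
  · have h1 : 0 < s ^ 2 - 1 := by nlinarith
    refine integral_window_eq_closed hs hper (by fun_prop)
      (C := fun β => 1 / (s ^ 2 - 1) ^ (5 / 2 : ℝ)
        * log ((√(s + 1) * (1 + sin β) + √(s - 1) * cos β)
        / (√(s + 1) * (1 + sin β) - √(s - 1) * cos β))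
        - cos β * ((2 * s ^ 3 + s) * sin β ^ 2 + 3 * (s ^ 2 + 1) * sin β
        - 2 * s ^ 3 + 5 * s) / (3 * (s ^ 2 - 1) ^ 2 * (1 + s * sin β) ^ 3))
      (fun β hβ => ?_) (antiperiodic_closedJ1 s) (fun β hβ => ?_) α
    · have h0 := sin_nonneg_of_mem_Icc hβ
      refine (((hasDerivAt_logTerm_sin h h0).const_mul _).sub
        (hasDerivAt_ratTerm1_sin h1.ne' (hd β hβ))).congr_deriv ?_
      have hr : √(s ^ 2 - 1) ≠ 0 := (sqrt_pos.2 h1).ne'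
      have := hd β hβ
      rw [rpow_five_halves h1, sin_sub_pi_div_two]
      field_simp
      ring
    · rw [closedJ1, if_pos h, logTerm, ratTerm1, abs_of_nonneg (sin_nonneg_of_mem_Icc hβ)]

theorem amoebaJ3_eq_closedJ3 {s : ℝ} (hs : 0 < s) (α : ℝ) :
    amoebaJ3 nuL1 s α = closedJ3 s α := by
  have hper : Function.Periodic (fun θ => cos θ ^ 2) π := fun θ => by simp
  have hd : ∀ β ∈ Icc 0 π, 1 + s * sin β ≠ 0 := fun β hβ => by
    have := mul_nonneg hs.le (sin_nonneg_of_mem_Icc hβ)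
    linarith
  rcases lt_trichotomy s 1 with h | h | h
  · have h1 : 0 < 1 - s ^ 2 := by nlinarith
    refine integral_window_eq_closed hs hper (by fun_prop)
      (C := fun β => (8 * s ^ 2 + 2) / (1 - s ^ 2) ^ (7 / 2 : ℝ)
        * arctan (√((1 - s) / (1 + s)) * (cos β / (1 + sin β)))
        + cos β * (s * (2 * s ^ 2 + 13) + 3 * (2 * s ^ 4 + 9 * s ^ 2 - 1) * sin β
        + s * (6 * s ^ 4 + 10 * s ^ 2 - 1) * sin β ^ 2)
        / (3 * (s ^ 2 - 1) ^ 3 * (1 + s * sin β) ^ 3))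
      (fun β hβ => ?_) (antiperiodic_closedJ3 s) (fun β hβ => ?_) α
    · have h0 := sin_nonneg_of_mem_Icc hβ
      refine (((hasDerivAt_arctanTerm_sin hs.le h h0).const_mul _).add
        (hasDerivAt_ratTerm3_sin (by linarith) (hd β hβ))).congr_deriv ?_
      have hr : √(1 - s ^ 2) ≠ 0 := (sqrt_pos.2 h1).ne'
      have := hd β hβ
      rw [rpow_seven_halves h1, cos_sub_pi_div_two]
      have e : s ^ 2 - 1 = -(1 - s ^ 2) := by ring
      rw [e]
      field_simp
      ring
    · rw [closedJ3, if_neg h.le.not_gt, if_neg h.ne, arctanTerm, ratTerm3,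
        abs_of_nonneg (sin_nonneg_of_mem_Icc hβ)]
  · subst h
    refine integral_window_eq_closed hs hper (by fun_prop)
      (C := fun β => 2 * cos β * (8 + 32 * sin β + 52 * sin β ^ 2 + 13 * sin β ^ 3)
        / (105 * (1 + sin β) ^ 4))
      (fun β hβ => ?_) (antiperiodic_closedJ3 1) (fun β hβ => ?_) α
    · have hS := hasDerivAt_sin β
      have hc := hasDerivAt_cos β
      have hd' := hd β hβ
      have h2 : cos β ^ 2 = 1 - sin β ^ 2 := by rw [← sin_sq_add_cos_sq β]; ring
      rw [one_mul] at *
      refine (((hc.const_mul 2).mul ((((hS.const_mul 32).const_add 8).add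
        ((hS.pow 2).const_mul 52)).add ((hS.pow 3).const_mul 13))).div
        ((hS.const_add 1 |>.pow 4).const_mul 105)
        (mul_ne_zero (by norm_num) (pow_ne_zero 4 hd'))).congr_deriv ?_
      simp only [Pi.mul_apply, Pi.pow_apply, Pi.add_apply, cos_sub_pi_div_two]
      clear hS hc hd
      generalize sin β = x at *
      generalize cos β = c at *
      simp only [Nat.add_one_sub_one, Nat.cast_ofNat]
      field_simp
      rw [h2]
      ring
    · rw [closedJ3, if_neg (lt_irrefl _), if_pos rfl, abs_of_nonneg (sin_nonneg_of_mem_Icc hβ)]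
  · have h1 : 0 < s ^ 2 - 1 := by nlinarith
    refine integral_window_eq_closed hs hper (by fun_prop)
      (C := fun β => -(4 * s ^ 2 + 1) / (s ^ 2 - 1) ^ (7 / 2 : ℝ)
        * log ((√(s + 1) * (1 + sin β) + √(s - 1) * cos β)
        / (√(s + 1) * (1 + sin β) - √(s - 1) * cos β))
        + cos β * (s * (2 * s ^ 2 + 13) + 3 * (2 * s ^ 4 + 9 * s ^ 2 - 1) * sin β
        + s * (6 * s ^ 4 + 10 * s ^ 2 - 1) * sin β ^ 2)
        / (3 * (s ^ 2 - 1) ^ 3 * (1 + s * sin β) ^ 3))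
      (fun β hβ => ?_) (antiperiodic_closedJ3 s) (fun β hβ => ?_) α
    · have h0 := sin_nonneg_of_mem_Icc hβ
      refine (((hasDerivAt_logTerm_sin h h0).const_mul _).add
        (hasDerivAt_ratTerm3_sin h1.ne' (hd β hβ))).congr_deriv ?_
      have hr : √(s ^ 2 - 1) ≠ 0 := (sqrt_pos.2 h1).ne'
      have := hd β hβ
      rw [rpow_seven_halves h1, cos_sub_pi_div_two]
      field_simp
      ring
    · rw [closedJ3, if_pos h, logTerm, ratTerm3, abs_of_nonneg (sin_nonneg_of_mem_Icc hβ)]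

/-! ### Limits of the coefficients as s tends to 0 from the right. -/

/-- Below 1 a single branch `D` of the closed form applies, and it is continuous at 0. The integral
at s = 0 is not used; there `deriv nuL1` would take the default value 0. -/
theorem tendsto_zero_right_of_eqOn {F C D : ℝ → ℝ} (hF : ∀ s, 0 < s → F s = C s)
    (hCD : ∀ s < 1, C s = D s) (hD : ContinuousAt D 0) : Tendsto F (𝓝[>] 0) (𝓝 (C 0)) := by
  rw [hCD 0 one_pos]
  refine (hD.tendsto.mono_left nhdsWithin_le_nhds).congr' ?_
  filter_upwards [Ioo_mem_nhdsGT (one_pos : (0 : ℝ) < 1)] with s hs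
  rw [hF s hs.1, hCD s hs.2]

theorem tendsto_amoebaJ1_zero (α : ℝ) :
    Tendsto (fun s => amoebaJ1 nuL1 s α) (𝓝[>] 0) (𝓝 (closedJ1 0 α)) := by
  refine tendsto_zero_right_of_eqOn (C := fun s => closedJ1 s α)
    (D := fun s => 2 / (1 - s ^ 2) ^ (5 / 2 : ℝ) * arctanTerm s α - ratTerm1 s α)
    (fun s hs => amoebaJ1_eq_closedJ1 hs α)
    (fun s hs => by rw [closedJ1, if_neg hs.le.not_gt, if_neg hs.ne]) ?_
  unfold arctanTerm ratTerm1
  fun_prop (disch := norm_num)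

theorem tendsto_amoebaJ2_zero (α : ℝ) :
    Tendsto (fun s => amoebaJ2 nuL1 s α) (𝓝[>] 0) (𝓝 (closedJ2 0 α)) := by
  refine tendsto_zero_right_of_eqOn (C := fun s => closedJ2 s α)
    (fun s hs => amoebaJ2_eq_closedJ2 hs α) (fun _ _ => rfl) ?_
  unfold closedJ2
  fun_prop (disch := norm_num)

theorem tendsto_amoebaJ3_zero (α : ℝ) :
    Tendsto (fun s => amoebaJ3 nuL1 s α) (𝓝[>] 0) (𝓝 (closedJ3 0 α)) := by
  refine tendsto_zero_right_of_eqOn (C := fun s => closedJ3 s α)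
    (D := fun s => (8 * s ^ 2 + 2) / (1 - s ^ 2) ^ (7 / 2 : ℝ) * arctanTerm s α + ratTerm3 s α)
    (fun s hs => amoebaJ3_eq_closedJ3 hs α)
    (fun s hs => by rw [closedJ3, if_neg hs.le.not_gt, if_neg hs.ne]) ?_
  unfold arctanTerm ratTerm3
  fun_prop (disch := norm_num)

/-! ### Areas of thin sets. -/

theorem volume_box_le {c₁ c₂ : ℝ} (R : ℝ) (h₂ : 0 ≤ c₂) :
    volume {z : ℂ | |z.im| ≤ c₁ ∧ |(|z.re| - R)| ≤ c₂} ≤ ENNReal.ofReal (8 * c₁ * c₂) := by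
  have hsub : {z : ℂ | |z.im| ≤ c₁ ∧ |(|z.re| - R)| ≤ c₂} ⊆
      Complex.measurableEquivRealProd ⁻¹'
        ((Icc (R - c₂) (R + c₂) ∪ Icc (-R - c₂) (-R + c₂)) ×ˢ Icc (-c₁) c₁) := by
    rintro z ⟨h1, h2⟩
    simp only [mem_preimage, Complex.measurableEquivRealProd_apply, mem_prod, mem_union, mem_Icc]
    rw [abs_le] at h1 h2
    refine ⟨?_, h1⟩
    rcases abs_cases z.re with h | h
    · left; constructor <;> linarith
    · right; constructor <;> linarith
  refine (measure_mono hsub).trans ?_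
  rw [Complex.volume_preserving_equiv_real_prod.measure_preimage_equiv, Measure.volume_eq_prod,
    Measure.prod_prod, Real.volume_Icc]
  calc _ ≤ (ENNReal.ofReal (2 * c₂) + ENNReal.ofReal (2 * c₂)) * ENNReal.ofReal (c₁ - -c₁) := by
        gcongr
        refine (measure_union_le _ _).trans ?_
        rw [Real.volume_Icc, Real.volume_Icc]
        gcongr <;> linarith
    _ = _ := by
        rw [← ENNReal.ofReal_add (by positivity) (by positivity),
          ← ENNReal.ofReal_mul (by positivity)]
        congr 1
        ring

/-- By Fubini: each vertical slice over [−1, 1] has length at most 2c, however `β` varies. -/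
theorem volume_graph_strip_le {β : ℝ → ℝ} (hβ : Measurable β) {c : ℝ} (hc : 0 ≤ c) :
    volume {z : ℂ | |z.im + β z.re| ≤ c ∧ |z.re| ≤ 1} ≤ ENNReal.ofReal (4 * c) := by
  set T : Set (ℝ × ℝ) := {p | |p.2 + β p.1| ≤ c ∧ |p.1| ≤ 1} with hT
  have hTm : MeasurableSet T := by
    apply MeasurableSet.inter
    · exact measurableSet_le (measurable_snd.add (hβ.comp measurable_fst)).abs measurable_const
    · exact measurableSet_le measurable_fst.abs measurable_const
  have : {z : ℂ | |z.im + β z.re| ≤ c ∧ |z.re| ≤ 1} = Complex.measurableEquivRealProd ⁻¹' T := rfl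
  rw [this, Complex.volume_preserving_equiv_real_prod.measure_preimage_equiv,
    Measure.volume_eq_prod, Measure.prod_apply hTm]
  calc _ ≤ ∫⁻ x : ℝ, (Icc (-1 : ℝ) 1).indicator (fun _ => ENNReal.ofReal (2 * c)) x := by
        refine lintegral_mono fun x => ?_
        by_cases hx : x ∈ Icc (-1 : ℝ) 1
        · rw [indicator_of_mem hx]
          calc _ ≤ volume (Icc (-β x - c) (-β x + c)) := by
                refine measure_mono fun y hy => ?_
                have := abs_le.1 hy.1
                dsimp only at this
                constructor <;> linarith
            _ ≤ _ := by
                rw [Real.volume_Icc]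
                gcongr
                linarith
        · rw [indicator_of_notMem hx]
          have : Prod.mk x ⁻¹' T = ∅ := by
            ext y
            simp only [hT, mem_preimage, mem_ofPred_eq, mem_empty_iff_false, iff_false, not_and]
            exact fun _ h => hx (abs_le.1 h)
          rw [this, measure_empty]
    _ = _ := by
        rw [lintegral_indicator_const measurableSet_Icc, Real.volume_Icc,
          ← ENNReal.ofReal_mul (by positivity)]
        congr 1
        ring

open scoped Pointwise in
/-- The area between two level sets of a positively homogeneous function. -/
theorem volume_homogeneous_band_le {g : ℂ → ℝ} (hg : Measurable g)
    (hhom : ∀ t : ℝ, 0 < t → ∀ z, g (t • z) = t * g z) (hbd : ∀ z, ‖z‖ ≤ 2 * g z) {a b : ℝ}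
    (ha : 0 < a) (hab : a ≤ b) :
    volume {z | a < g z ∧ g z ≤ b} ≤ ENNReal.ofReal ((b ^ 2 - a ^ 2) * (4 * π)) := by
  -- Sublevel sets are dilates of one another, so areas scale as t² and the band is a difference of
  -- two such areas.
  have hlev : ∀ t : ℝ, 0 < t → volume {z | g z ≤ t} = ENNReal.ofReal (t ^ 2) * volume {z | g z ≤ 1} := by
    intro t ht
    have : {z | g z ≤ t} = t • {z | g z ≤ 1} := by
      ext z
      rw [mem_smul_set_iff_inv_smul_mem₀ ht.ne']
      simp only [mem_ofPred_eq, hhom t⁻¹ (inv_pos.2 ht)]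
      rw [inv_mul_le_iff₀ ht, mul_one]
    rw [this, Measure.addHaar_smul, Complex.finrank_real_complex, abs_of_pos (by positivity)]
  have h1 : volume {z | g z ≤ 1} ≤ ENNReal.ofReal (4 * π) := by
    refine (measure_mono (t := Metric.closedBall 0 2) fun z hz => ?_).trans ?_
    · have h : g z ≤ 1 := hz
      rw [mem_closedBall_zero_iff]
      linarith [hbd z]
    · rw [Complex.volume_closedBall, ENNReal.ofReal_mul (by norm_num)]
      refine le_of_eq ?_
      congr 1
      · rw [← ENNReal.ofReal_pow (by norm_num)]; norm_num
      · rw [← NNReal.coe_real_pi, ENNReal.ofReal_coe_nnreal]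
  have hfin : ∀ t : ℝ, 0 < t → volume {z | g z ≤ t} ≠ ⊤ := fun t ht => by
    rw [hlev t ht]
    exact ENNReal.mul_ne_top ENNReal.ofReal_ne_top (h1.trans_lt ENNReal.ofReal_lt_top).ne
  have hset : {z | a < g z ∧ g z ≤ b} = {z | g z ≤ b} \ {z | g z ≤ a} := by
    ext z
    simp only [mem_ofPred_eq, Set.mem_sdiff, not_le]
    tauto
  have hsub : {z | g z ≤ a} ⊆ {z | g z ≤ b} := fun z hz => le_trans hz hab
  rw [hset, measure_sdiff hsub
    (measurableSet_le hg measurable_const).nullMeasurableSet (hfin a ha), hlev a ha,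
    hlev b (ha.trans_le hab), ← ENNReal.sub_mul (fun _ _ => (h1.trans_lt ENNReal.ofReal_lt_top).ne),
    ← ENNReal.ofReal_sub _ (by positivity), ENNReal.ofReal_mul]
  · gcongr
  · nlinarith

/-! ### The rescaled amoeba norm and its perturbation. -/

/-- The linear part of the image in the coordinate system adapted to `∇u`. -/
noncomputable def linPart (s α : ℝ) (z : ℂ) : ℝ := s * (cos α * z.im + sin α * z.re)

/-- The amoeba norm at the centre, in the coordinate system adapted to `∇u`. -/
noncomputable def amoebaNorm (s α : ℝ) (z : ℂ) : ℝ := ‖z‖ + |linPart s α z|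

/-- The first-order perturbation of the amoeba norm, of degree zero. -/
noncomputable def normPert (s α : ℝ) (h : ℂ → ℝ) (z : ℂ) : ℝ :=
  SignType.sign (linPart s α z) * h z / amoebaNorm s α z ^ 2

theorem linPart_eq (s α : ℝ) (z : ℂ) :
    linPart s α z = s * (z * Complex.exp (α * Complex.I)).im := by
  rw [linPart, Complex.mul_im, Complex.exp_ofReal_mul_I_re, Complex.exp_ofReal_mul_I_im]
  ring

theorem linPart_smul (s α t : ℝ) (z : ℂ) : linPart s α (t • z) = t * linPart s α z := by
  simp only [linPart, Complex.smul_im, Complex.smul_re, smul_eq_mul]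
  ring

theorem continuous_linPart (s α : ℝ) : Continuous (linPart s α) := by
  unfold linPart
  fun_prop

theorem continuous_amoebaNorm (s α : ℝ) : Continuous (amoebaNorm s α) :=
  continuous_norm.add (continuous_linPart s α).abs

theorem abs_linPart_le {s : ℝ} (hs : 0 ≤ s) (α : ℝ) (z : ℂ) : |linPart s α z| ≤ s * ‖z‖ := by
  rw [linPart_eq, abs_mul, abs_of_nonneg hs]
  gcongr
  refine (Complex.abs_im_le_norm _).trans ?_
  rw [norm_mul, Complex.norm_exp_ofReal_mul_I, mul_one]

theorem norm_le_amoebaNorm (s α : ℝ) (z : ℂ) : ‖z‖ ≤ amoebaNorm s α z :=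
  le_add_of_nonneg_right (abs_nonneg _)

theorem amoebaNorm_smul (s α : ℝ) {t : ℝ} (ht : 0 ≤ t) (z : ℂ) :
    amoebaNorm s α (t • z) = t * amoebaNorm s α z := by
  rw [amoebaNorm, linPart_smul, norm_smul, abs_mul, norm_of_nonneg ht, abs_of_nonneg ht,
    amoebaNorm]
  ring

theorem abs_sign_le_one (x : ℝ) : |((SignType.sign x : SignType) : ℝ)| ≤ 1 := by
  rcases lt_trichotomy x 0 with h | h | h <;> simp [h]

theorem measurable_sign_real : Measurable fun x : ℝ => ((SignType.sign x : SignType) : ℝ) := by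
  have : (fun x : ℝ => ((SignType.sign x : SignType) : ℝ))
      = fun x => if 0 < x then 1 else if x < 0 then -1 else 0 := by
    ext x
    rcases lt_trichotomy x 0 with h | h | h
    · simp [h, h.not_gt]
    · simp [h]
    · simp [h]
  rw [this]
  exact Measurable.ite measurableSet_Ioi measurable_const
    (Measurable.ite measurableSet_Iio measurable_const measurable_const)

theorem measurable_normPert (s α : ℝ) {h : ℂ → ℝ} (hh : Measurable h) :
    Measurable (normPert s α h) :=
  ((measurable_sign_real.comp (continuous_linPart s α).measurable).mul hh).div
    ((continuous_amoebaNorm s α).measurable.pow_const 2)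

theorem normPert_smul (s α : ℝ) {h : ℂ → ℝ} (hh : ∀ (t : ℝ) z, h (t • z) = t ^ 2 * h z) {t : ℝ}
    (ht : 0 < t) (z : ℂ) : normPert s α h (t • z) = normPert s α h z := by
  have : SignType.sign (t * linPart s α z) = SignType.sign (linPart s α z) := by
    rw [sign_mul, sign_pos ht, one_mul]
  rw [normPert, linPart_smul, hh, amoebaNorm_smul s α ht.le, normPert, this]
  rw [mul_pow, mul_left_comm, mul_div_mul_left _ _ (by positivity)]

/-- This oddness is the asymmetry of the amoeba: one side grows where the opposite side shrinks. It
keeps the shape term from cancelling to first order. -/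
theorem normPert_neg (s α : ℝ) {h : ℂ → ℝ} (hh : ∀ (t : ℝ) z, h (t • z) = t ^ 2 * h z) (z : ℂ) :
    normPert s α h (-z) = -normPert s α h z := by
  have h1 := linPart_smul s α (-1) z
  have h2 := hh (-1) z
  rw [neg_one_smul] at h1 h2
  rw [normPert, normPert, amoebaNorm, amoebaNorm, h1, h2, norm_neg, neg_one_mul, abs_neg,
    Left.sign_neg, SignType.coe_neg]
  ring

theorem abs_normPert_le (s α : ℝ) {h : ℂ → ℝ} {H : ℝ} (hH : ∀ z, |h z| ≤ H * ‖z‖ ^ 2) (z : ℂ) :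
    |normPert s α h z| ≤ H := by
  have hH0 : 0 ≤ H := by simpa using (abs_nonneg _).trans (hH 1)
  rw [normPert, abs_div, abs_mul, abs_of_nonneg (sq_nonneg (amoebaNorm s α z))]
  refine div_le_of_le_mul₀ (sq_nonneg _) hH0 ?_
  calc _ ≤ 1 * (H * ‖z‖ ^ 2) := mul_le_mul (abs_sign_le_one _) (hH z) (abs_nonneg _) zero_le_one
    _ ≤ _ := by
      rw [one_mul]
      have := norm_le_amoebaNorm s α z
      gcongr

/-- A rotation by `α` turns the linear form into s Im z. In the narrow strip the norm is close to
|Re z|, so the set lies in two boxes with both sides of order c. -/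
theorem volume_strip_inter_band_le {s : ℝ} (hs : 0 < s) (α : ℝ) {c : ℝ} (hc : 0 ≤ c) :
    volume {z : ℂ | |linPart s α z| ≤ c ∧ |amoebaNorm s α z - 1| ≤ c}
      ≤ ENNReal.ofReal (8 * (c / s) * (2 * c + c / s)) := by
  set e : ℂ ≃ₗᵢ[ℝ] ℂ := rotation (Circle.exp α) with he
  have hsub : {z : ℂ | |linPart s α z| ≤ c ∧ |amoebaNorm s α z - 1| ≤ c} ⊆
      e.toMeasurableEquiv ⁻¹' {z : ℂ | |z.im| ≤ c / s ∧ |(|z.re| - 1)| ≤ 2 * c + c / s} := by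
    rintro z ⟨h1, h2⟩
    have hez : e z = z * Complex.exp (α * Complex.I) := by
      rw [he, rotation_apply, Circle.coe_exp, mul_comm]
    have him : |(e z).im| ≤ c / s := by
      rw [linPart_eq, abs_mul, abs_of_pos hs, ← hez] at h1
      rw [le_div_iff₀ hs]
      linarith
    refine ⟨him, ?_⟩
    have hn : ‖e z‖ = ‖z‖ := e.norm_map z
    have h3 := Complex.norm_le_abs_re_add_abs_im (e z)
    have h4 := Complex.abs_re_le_norm (e z)
    rw [amoebaNorm, abs_le] at h2
    have h5 := abs_nonneg (linPart s α z)
    change |(|(e z).re| - 1)| ≤ _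
    have : 0 ≤ c / s := by positivity
    rw [abs_le]
    constructor <;> linarith
  refine (measure_mono hsub).trans ?_
  rw [e.measurePreserving.measure_preimage_equiv (f := e.toMeasurableEquiv)]
  exact volume_box_le 1 (by positivity)

/-- `normPert` has degree zero, so dividing the amoeba norm by 1 − ρκ, with κ = `normPert`, keeps it
positively homogeneous. The set is then a thin band between two level sets of this quotient. -/
theorem volume_amoebaNorm_band_le (s α : ℝ) {h : ℂ → ℝ} (hm : Measurable h)
    (hh : ∀ (t : ℝ) z, h (t • z) = t ^ 2 * h z) {H : ℝ} (hH : ∀ z, |h z| ≤ H * ‖z‖ ^ 2)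
    {ρ δ : ℝ} (hρ : 0 ≤ ρ) (hρH : ρ * H ≤ 1 / 2) (hδ : 0 < δ) (hδ' : δ ≤ 1 / 6) :
    volume {z : ℂ | |amoebaNorm s α z - 1 + ρ * normPert s α h z| ≤ δ}
      ≤ ENNReal.ofReal (48 * π * δ) := by
  have hκ : ∀ z, |ρ * normPert s α h z| ≤ 1 / 2 := fun z => by
    rw [abs_mul, abs_of_nonneg hρ]
    exact (mul_le_mul_of_nonneg_left (abs_normPert_le s α hH z) hρ).trans hρH
  have hpos : ∀ z, 1 / 2 ≤ 1 - ρ * normPert s α h z := fun z => by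
    have := (abs_le.1 (hκ z)).2
    linarith
  have hpos' : ∀ z, 1 - ρ * normPert s α h z ≤ 2 := fun z => by
    have := (abs_le.1 (hκ z)).1
    linarith
  set g : ℂ → ℝ := fun z => amoebaNorm s α z / (1 - ρ * normPert s α h z) with hg
  have := volume_homogeneous_band_le (g := g) (a := 1 - 3 * δ) (b := 1 + 3 * δ)
    ((continuous_amoebaNorm s α).measurable.div
      (((measurable_normPert s α hm).const_mul ρ).const_sub 1))
    (fun t ht z => by
      simp only [hg]
      rw [normPert_smul s α hh ht, amoebaNorm_smul s α ht.le, mul_div_assoc])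
    (fun z => by
      have h1 := norm_le_amoebaNorm s α z
      have h2 := hpos' z
      have h3 := hpos z
      simp only [hg]
      rw [mul_div_assoc', le_div_iff₀ (by linarith)]
      nlinarith [norm_nonneg z]) (by linarith) (by linarith)
  -- As 1 − ρκ ≥ 1/2, the quotient is within 2δ of 1; the margin 3δ makes the lower inequality
  -- strict. Then (1 + 3δ)² − (1 − 3δ)² = 12δ gives the constant 48π.
  refine (measure_mono fun z hz => ?_).trans (this.trans ?_)
  · have h1 := abs_le.1 (show |amoebaNorm s α z - 1 + ρ * normPert s α h z| ≤ δ from hz)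
    have h2 := hpos z
    constructor
    · simp only [hg]
      rw [lt_div_iff₀ (by linarith)]
      nlinarith
    · simp only [hg]
      rw [div_le_iff₀ (by linarith)]
      nlinarith
  · refine ENNReal.ofReal_le_ofReal (le_of_eq ?_)
    ring

/-! ### Pointwise comparison with the first-order models. -/

/-- The perturbed amoeba and its first-order model agree off a strip and a thin band. -/
theorem norm_add_abs_le_one_iff {r G η F s H M ρ : ℝ} (hr : 0 ≤ r) (hG : |G| ≤ s * r)
    (hη : |η| ≤ H * r ^ 2) (hF : r ≤ 1 → |F - (G + ρ * η)| ≤ M * ρ ^ 2) (hs : 0 ≤ s) (hH : 0 ≤ H)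
    (hM : 0 ≤ M) (hρ : 0 < ρ) (hρ1 : ρ ≤ 1) (hρH : ρ * (H * (2 + s)) ≤ 1 / 2)
    (hstrip : ¬(|G| ≤ (H + M) * ρ ∧ |r + |G| - 1| ≤ (H + M) * ρ))
    (hband : ¬|r + |G| - 1 + ρ * (SignType.sign G * η / (r + |G|) ^ 2)|
      ≤ 2 * (H ^ 2 * (2 + s) + M) * ρ ^ 2) :
    r + |F| ≤ 1 ↔ r + |G| ≤ 1 - ρ * (SignType.sign G * η / (r + |G|) ^ 2) := by
  have hG0 := abs_nonneg G
  set N := r + |G| with hN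
  have hrN : r ≤ N := by linarith
  set κ := SignType.sign G * η / N ^ 2 with hκ
  have hηN : |SignType.sign G * η| ≤ H * N ^ 2 := by
    rw [abs_mul]
    calc _ ≤ 1 * |η| := by gcongr; exact abs_sign_le_one G
      _ ≤ H * r ^ 2 := by rwa [one_mul]
      _ ≤ H * N ^ 2 := by gcongr
  have hκH : |κ| ≤ H := by
    rw [hκ, abs_div, abs_of_nonneg (sq_nonneg N)]
    exact div_le_of_le_mul₀ (sq_nonneg _) hH hηN
  have hκN : SignType.sign G * η = κ * N ^ 2 := by
    rcases eq_or_ne N 0 with h | h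
    · rw [h, zero_pow two_ne_zero, mul_zero] at hηN ⊢
      exact abs_nonpos_iff.1 hηN
    · rw [hκ]
      field_simp
  obtain ⟨hκ1, hκ2⟩ := abs_le.1 hκH
  have hρκ1 : ρ * κ ≤ H * ρ := by nlinarith
  have hρκ2 : -(H * ρ) ≤ ρ * κ := by nlinarith
  have hMρ : M * ρ ^ 2 ≤ M * ρ := by nlinarith [mul_nonneg hM hρ.le]
  have hMρ0 : 0 ≤ M * ρ := by positivity
  -- For r > 1 the bound `hF` is unavailable. Such a point lies outside the true set, and if it lay
  -- in the model set, r > 1 would force both |G| and N − 1 to be O(ρ), against `hstrip`.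
  rcases le_or_gt r 1 with hr1 | hr1
  swap
  · have h1 : ¬ r + |F| ≤ 1 := by linarith [abs_nonneg F]
    refine iff_of_false h1 fun h2 => hstrip ⟨?_, abs_le.2 ⟨?_, ?_⟩⟩ <;> nlinarith
  have hF' := hF hr1
  have hη' : |ρ * η| ≤ H * ρ := by
    rw [abs_mul, abs_of_pos hρ]
    have : H * r ^ 2 ≤ H := mul_le_of_le_one_right hH (pow_le_one₀ hr hr1)
    nlinarith
  -- Where |G| is small its sign does not control the sign of F. There `hstrip` keeps N away from 1
  -- by more than the perturbation, so both conditions are decided by N alone.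
  rcases le_or_gt |G| ((H + M) * ρ) with hGs | hGs
  · have hb : ¬ |N - 1| ≤ (H + M) * ρ := fun h => hstrip ⟨hGs, h⟩
    have hFG : |(|F| - |G|)| ≤ (H + M) * ρ := by
      calc _ ≤ |F - G| := abs_abs_sub_abs_le_abs_sub F G
        _ = |(F - (G + ρ * η)) + ρ * η| := by ring_nf
        _ ≤ _ := (abs_add_le _ _).trans (by linarith)
    rw [abs_le] at hFG
    rw [not_le, lt_abs] at hb
    rcases hb with hb | hb
    · exact iff_of_false (by linarith) (by linarith)
    · exact iff_of_true (by linarith) (by linarith)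
  · have hFabs : |(|F| - (|G| + ρ * (SignType.sign G * η)))| ≤ M * ρ ^ 2 := by
      rw [abs_le] at hη' hF'
      rcases lt_trichotomy G 0 with h | h | h
      · rw [abs_of_neg h] at hGs ⊢
        rw [sign_neg h, abs_of_neg (show F < 0 by linarith), abs_le]
        simp only [SignType.coe_neg, SignType.coe_one]
        constructor <;> linarith
      · rw [h, abs_zero] at hGs
        have : 0 ≤ (H + M) * ρ := by positivity
        linarith
      · rw [abs_of_pos h] at hGs ⊢
        rw [sign_pos h, abs_of_pos (show 0 < F by linarith), abs_le]
        simp only [SignType.coe_one]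
        constructor <;> linarith
    rw [hκN, abs_le] at hFabs
    have hNs : N ≤ 1 + s := by nlinarith
    have hN0 : 0 ≤ N := hr.trans hrN
    have hN2 : N + 1 ≤ 2 + s := by linarith
    set δ := N - 1 + ρ * κ with hδ
    -- This compares N + ρκN² ≤ 1 with N ≤ 1 − ρκ. The two differ by a positive factor and an O(ρ²)
    -- term, which `hband` absorbs; the second form is explicit along each ray.
    have hid : N + ρ * (κ * N ^ 2) - 1 = δ * (1 + ρ * κ * (N + 1)) - ρ ^ 2 * κ ^ 2 * (N + 1) := by
      rw [hδ]
      ring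
    have hfac : 1 / 2 ≤ 1 + ρ * κ * (N + 1) := by
      have h1 : |ρ * κ * (N + 1)| ≤ 1 / 2 := by
        rw [abs_mul, abs_mul, abs_of_pos hρ, abs_of_nonneg (by linarith : 0 ≤ N + 1)]
        calc ρ * |κ| * (N + 1) ≤ ρ * H * (2 + s) :=
              mul_le_mul (by gcongr) hN2 (by linarith) (by positivity)
          _ ≤ 1 / 2 := by linarith
      linarith [(abs_le.1 h1).1]
    have hrem : ρ ^ 2 * κ ^ 2 * (N + 1) ≤ H ^ 2 * (2 + s) * ρ ^ 2 := by
      have h1 : κ ^ 2 ≤ H ^ 2 := sq_le_sq' hκ1 hκ2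
      calc ρ ^ 2 * κ ^ 2 * (N + 1) ≤ ρ ^ 2 * H ^ 2 * (2 + s) :=
            mul_le_mul (by gcongr) hN2 (by linarith) (by positivity)
        _ = _ := by ring
    have hrem0 : 0 ≤ ρ ^ 2 * κ ^ 2 * (N + 1) := by positivity
    rw [not_le, lt_abs] at hband
    have hM2 : 0 ≤ M * ρ ^ 2 := by positivity
    have hH2 : 0 ≤ H ^ 2 * (2 + s) * ρ ^ 2 := by positivity
    rcases hband with hb | hb
    · refine iff_of_false ?_ ?_
      · have : δ * (1 / 2) ≤ δ * (1 + ρ * κ * (N + 1)) := by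
          apply mul_le_mul_of_nonneg_left hfac
          linarith
        linarith
      · linarith
    · refine iff_of_true ?_ ?_
      · have : (-δ) * (1 / 2) ≤ (-δ) * (1 + ρ * κ * (N + 1)) := by
          apply mul_le_mul_of_nonneg_left hfac
          linarith
        linarith
      · linarith

theorem sign_eq_of_abs_sub_lt {x y : ℝ} (h : |x - y| < |y|) :
    SignType.sign x = SignType.sign y := by
  rw [abs_lt] at h
  rcases lt_trichotomy y 0 with hy | hy | hy
  · rw [abs_of_neg hy] at h
    rw [sign_neg hy, sign_neg (by linarith)]
  · rw [hy, abs_zero] at h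
    linarith
  · rw [abs_of_pos hy] at h
    rw [sign_pos hy, sign_pos (by linarith)]

/-- Near the real axis the amoeba norm is essentially that of the projection, which places the
amoeba's tips on the axis near ±1 / `amoebaNorm s α 1`. -/
theorem abs_amoebaNorm_sub_le {s : ℝ} (hs : 0 ≤ s) (α : ℝ) (z : ℂ) :
    |amoebaNorm s α z - |z.re| * amoebaNorm s α 1| ≤ (1 + s) * |z.im| := by
  have h1 : |z.re| * amoebaNorm s α 1 = |z.re| + |s * (sin α * z.re)| := by
    rw [amoebaNorm, linPart, norm_one, Complex.one_im, Complex.one_re, mul_add, ← abs_mul]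
    ring_nf
  have h2 : |(|linPart s α z| - |s * (sin α * z.re)|)| ≤ s * |z.im| := by
    refine (abs_abs_sub_abs_le_abs_sub _ _).trans ?_
    rw [linPart, show s * (cos α * z.im + sin α * z.re) - s * (sin α * z.re)
      = s * (cos α * z.im) by ring, abs_mul, abs_of_nonneg hs, abs_mul]
    gcongr
    exact mul_le_of_le_one_left (abs_nonneg _) (abs_cos_le_one α)
  have h3 := Complex.norm_le_abs_re_add_abs_im z
  have h4 := Complex.abs_re_le_norm z
  rw [h1, amoebaNorm]
  rw [abs_le] at h2 ⊢
  have := abs_nonneg z.im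
  constructor <;> linarith

theorem one_le_amoebaNorm_one (s α : ℝ) : 1 ≤ amoebaNorm s α 1 := by
  simpa using norm_le_amoebaNorm s α 1

/-- The sign of the level function on the perturbed amoeba. -/
noncomputable def signOnAmoeba (F V : ℂ → ℝ) (z : ℂ) : ℝ :=
  if ‖z‖ + |F z| ≤ 1 then SignType.sign (V z) else 0

/-- The contribution of the asymmetry of the amoeba. -/
noncomputable def shapeModel (s α : ℝ) (h : ℂ → ℝ) (ρ : ℝ) (z : ℂ) : ℝ :=
  if amoebaNorm s α z ≤ 1 - ρ * normPert s α h z then SignType.sign z.im else 0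

/-- The contribution of the displacement and the curvature of the level line. -/
noncomputable def levelModel (R : ℝ) (β : ℝ → ℝ) (ρ : ℝ) (z : ℂ) : ℝ :=
  if |z.re| ≤ R ∧ |z.im| ≤ 1 then
    (SignType.sign (z.im + ρ * β z.re) : ℝ) - SignType.sign z.im
  else 0

/-- Far from the real axis V has the sign of Im z and only the shape counts. Near the axis and well
inside the tips, both shapes contain the point and only the displaced level line counts; well
outside the tips, everything vanishes. The four excluded sets are the ambiguous zones: around the
tips, around the displaced line, around the amoeba boundary, and around the boundary points where
the linear form vanishes. -/
theorem signOnAmoeba_eq {s α H M ρ w B L k K : ℝ} {h b F V : ℂ → ℝ} {z : ℂ}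
    (hs : 0 ≤ s) (hH : ∀ z, |h z| ≤ H * ‖z‖ ^ 2) (hM : 0 ≤ M)
    (hw : 0 < w) (hB : ∀ z, |b z| ≤ B * ‖z‖ ^ 2) (hL : 0 ≤ L)
    (hbL : ‖z‖ ≤ 1 → |b z - b z.re| ≤ L * |z.im|) (hk : |k| ≤ K)
    (hF : ‖z‖ ≤ 1 → |F z - (linPart s α z + ρ * h z)| ≤ M * ρ ^ 2)
    (hV : ‖z‖ ≤ 1 → |V z - (w * z.im + ρ * (b z - k))| ≤ M * ρ ^ 2)
    (hρ : 0 < ρ) (hρ1 : ρ ≤ 1) (hρH : ρ * (H * (2 + s)) ≤ 1 / 2) (hρC : ρ * ((B + K + M) / w) ≤ 1)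
    (hbox : ¬(|z.im| ≤ (B + K + M) / w * ρ ∧
      |(|z.re| - 1 / amoebaNorm s α 1)| ≤ ((1 + s) * ((B + K + M) / w) + H) * ρ))
    (hline : ¬(|z.im + ρ * ((b z.re - k) / w)| ≤ (M + L * ((B + K + M) / w)) / w * ρ ^ 2
      ∧ |z.re| ≤ 1))
    (hband : ¬|amoebaNorm s α z - 1 + ρ * normPert s α h z|
      ≤ 2 * (H ^ 2 * (2 + s) + M) * ρ ^ 2)
    (hstrip : ¬(|linPart s α z| ≤ (H + M) * ρ ∧ |amoebaNorm s α z - 1| ≤ (H + M) * ρ)) :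
    signOnAmoeba F V z = shapeModel s α h ρ z
      + levelModel (1 / amoebaNorm s α 1) (fun x => (b x - k) / w) ρ z := by
  have hH0 : 0 ≤ H := by simpa using (abs_nonneg _).trans (hH 1)
  have hB0 : 0 ≤ B := by simpa using (abs_nonneg _).trans (hB 1)
  have hK0 : 0 ≤ K := (abs_nonneg _).trans hk
  have hiff : ‖z‖ + |F z| ≤ 1 ↔ amoebaNorm s α z ≤ 1 - ρ * normPert s α h z :=
    norm_add_abs_le_one_iff (norm_nonneg z) (abs_linPart_le hs α z) (hH z) hF hs hH0 hM hρ hρ1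
      hρH hstrip hband
  have hκ := abs_le.1 (abs_normPert_le s α hH z)
  have hρκ1 : ρ * normPert s α h z ≤ H * ρ := by nlinarith
  have hρκ2 : -(H * ρ) ≤ ρ * normPert s α h z := by nlinarith
  set C := (B + K + M) / w with hC
  have hC0 : 0 ≤ C := by positivity
  have hCw : C * w = B + K + M := by rw [hC]; field_simp
  have hN1 := one_le_amoebaNorm_one s α
  have hR1 : 1 / amoebaNorm s α 1 ≤ 1 := by
    rw [div_le_one (by linarith)]
    exact hN1
  have hMρ : M * ρ ^ 2 ≤ M * ρ := by nlinarith [mul_nonneg hM hρ.le]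
  have hbk : ∀ y : ℂ, ‖y‖ ≤ 1 → |b y - k| ≤ B + K := fun y hy =>
    (abs_sub _ _).trans (add_le_add ((hB y).trans
      (mul_le_of_le_one_right hB0 (pow_le_one₀ (norm_nonneg y) hy))) hk)
  simp only [signOnAmoeba, shapeModel, levelModel, hiff]
  -- C is chosen so that Cρ|∇u| dominates the whole perturbation of V on the unit disc.
  rcases lt_or_ge (C * ρ) |z.im| with him | him
  · have hQ : |z.re| ≤ 1 / amoebaNorm s α 1 →
        SignType.sign (z.im + ρ * ((b z.re - k) / w)) = SignType.sign z.im := by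
      intro hre
      apply sign_eq_of_abs_sub_lt
      rw [add_sub_cancel_left, abs_mul, abs_of_pos hρ, abs_div, abs_of_pos hw]
      refine lt_of_le_of_lt ?_ him
      rw [mul_comm]
      gcongr
      rw [hC]
      gcongr
      have := hbk z.re (by rw [Complex.norm_real, norm_eq_abs]; linarith)
      linarith
    have hQ0 : (if |z.re| ≤ 1 / amoebaNorm s α 1 ∧ |z.im| ≤ 1 then
        (SignType.sign (z.im + ρ * ((b z.re - k) / w)) : ℝ) - SignType.sign z.im else 0) = 0 := by
      split_ifs with h1
      · rw [hQ h1.1, sub_self]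
      · rfl
    rw [hQ0, add_zero]
    split_ifs with hS
    · have hz1 : ‖z‖ ≤ 1 := by linarith [hiff.2 hS, abs_nonneg (F z)]
      have hV' := hV hz1
      have hbz := hbk z hz1
      have : SignType.sign (V z) = SignType.sign (w * z.im) := by
        apply sign_eq_of_abs_sub_lt
        calc |V z - w * z.im| = |(V z - (w * z.im + ρ * (b z - k))) + ρ * (b z - k)| := by ring_nf
          _ ≤ M * ρ ^ 2 + ρ * (B + K) := by
            refine (abs_add_le _ _).trans ?_
            rw [abs_mul ρ, abs_of_pos hρ]
            gcongr
          _ ≤ C * w * ρ := by rw [hCw]; linarith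
          _ = w * (C * ρ) := by ring
          _ < w * |z.im| := by gcongr
          _ = |w * z.im| := by rw [abs_mul, abs_of_pos hw]
      rw [this, sign_mul, sign_pos hw, one_mul]
    · rfl
  · have hb : ¬ |(|z.re| - 1 / amoebaNorm s α 1)| ≤ ((1 + s) * C + H) * ρ :=
      fun h => hbox ⟨him, h⟩
    have hN := abs_le.1 (abs_amoebaNorm_sub_le hs α z)
    have hsim : (1 + s) * |z.im| ≤ (1 + s) * (C * ρ) := by gcongr
    have hRN : 1 / amoebaNorm s α 1 * amoebaNorm s α 1 = 1 := by field_simp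
    have hCρ : 0 ≤ ((1 + s) * C + H) * ρ := by positivity
    rw [not_le, lt_abs] at hb
    rcases hb with hb | hb
    · have hlt : 1 + H * ρ < amoebaNorm s α z := by
        have h1 : ((1 + s) * C + H) * ρ ≤ ((1 + s) * C + H) * ρ * amoebaNorm s α 1 :=
          le_mul_of_one_le_right hCρ hN1
        have h2 : (((1 + s) * C + H) * ρ + 1 / amoebaNorm s α 1) * amoebaNorm s α 1
            < |z.re| * amoebaNorm s α 1 := by
          apply mul_lt_mul_of_pos_right _ (by linarith)
          linarith
        rw [add_mul, hRN] at h2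
        linarith
      rw [if_neg (by linarith), if_neg (by linarith), if_neg (fun h => by linarith [h.1]), add_zero]
    · have hle : amoebaNorm s α z ≤ 1 - ρ * normPert s α h z := by
        have h1 : ((1 + s) * C + H) * ρ ≤ ((1 + s) * C + H) * ρ * amoebaNorm s α 1 :=
          le_mul_of_one_le_right hCρ hN1
        have h2 : |z.re| * amoebaNorm s α 1
            < (1 / amoebaNorm s α 1 - ((1 + s) * C + H) * ρ) * amoebaNorm s α 1 := by
          apply mul_lt_mul_of_pos_right _ (by linarith)
          linarith
        rw [sub_mul, hRN] at h2
        linarith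
      have hz1 : ‖z‖ ≤ 1 := by linarith [hiff.2 hle, abs_nonneg (F z)]
      have hre : |z.re| ≤ 1 / amoebaNorm s α 1 := by linarith
      rw [if_pos hle, if_pos hle, if_pos ⟨hre, by linarith⟩, add_sub_cancel]
      -- Replacing b(z) by b(Re z) costs only ρ · L|Im z| = O(ρ²) here, so a tube of width O(ρ²)
      -- around the line suffices.
      have hl : (M + L * C) / w * ρ ^ 2 < |z.im + ρ * ((b z.re - k) / w)| :=
        not_le.1 fun h => hline ⟨h, hre.trans hR1⟩
      have : SignType.sign (V z) = SignType.sign (w * (z.im + ρ * ((b z.re - k) / w))) := by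
        apply sign_eq_of_abs_sub_lt
        have e : w * (z.im + ρ * ((b z.re - k) / w)) = w * z.im + ρ * (b z.re - k) := by
          field_simp
        calc |V z - w * (z.im + ρ * ((b z.re - k) / w))|
            = |(V z - (w * z.im + ρ * (b z - k))) + ρ * (b z - b z.re)| := by rw [e]; ring_nf
          _ ≤ M * ρ ^ 2 + ρ * (L * (C * ρ)) := by
            refine (abs_add_le _ _).trans ?_
            rw [abs_mul ρ, abs_of_pos hρ]
            have h1 := hV hz1
            have h2 := hbL hz1
            gcongr
            exact h2.trans (by gcongr)
          _ = w * ((M + L * C) / w * ρ ^ 2) := by field_simp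
          _ < w * |z.im + ρ * ((b z.re - k) / w)| := by gcongr
          _ = _ := by rw [abs_mul, abs_of_pos hw]
      rw [this, sign_mul, sign_pos hw, one_mul]

/-! ### Exact integrals of the two models. -/

theorem intervalIntegral_congr_Ioo {f g : ℝ → ℝ} {a b : ℝ} (hab : a ≤ b)
    (h : ∀ x ∈ Ioo a b, f x = g x) : ∫ x in a..b, f x = ∫ x in a..b, g x := by
  rw [intervalIntegral.integral_of_le hab, intervalIntegral.integral_of_le hab,
    integral_Ioc_eq_integral_Ioo, integral_Ioc_eq_integral_Ioo,
    setIntegral_congr_fun measurableSet_Ioo h]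

theorem intervalIntegrable_of_bounded {f : ℝ → ℝ} (hf : Measurable f) {C : ℝ}
    (hC : ∀ x, |f x| ≤ C) (a b : ℝ) : IntervalIntegrable f volume a b :=
  (intervalIntegrable_const (c := C)).mono_fun hf.aestronglyMeasurable
    (Eventually.of_forall fun x => by
      exact (hC x).trans (le_abs_self C))

/-- The sign flips only between −c and 0, by 2 each time; |c| ≤ 1 keeps that interval inside the
domain. -/
theorem integral_sign_shift_sub {c : ℝ} (hc : |c| ≤ 1) :
    ∫ y in (-1 : ℝ)..1, ((SignType.sign (y + c) : ℝ) - SignType.sign y) = 2 * c := by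
  have hi : ∀ a b : ℝ, IntervalIntegrable (fun y : ℝ => ((SignType.sign y : SignType) : ℝ))
      volume a b := intervalIntegrable_of_bounded measurable_sign_real abs_sign_le_one
  have hneg : ∀ a ≤ 0, ∫ y in a..0, ((SignType.sign y : SignType) : ℝ) = a := fun a ha => by
    rw [intervalIntegral_congr_Ioo (g := fun _ => -1) ha fun x hx => by simp [sign_neg hx.2]]
    simp
  have hpos : ∀ b ≥ 0, ∫ y in 0..b, ((SignType.sign y : SignType) : ℝ) = b := fun b hb => by
    rw [intervalIntegral_congr_Ioo (g := fun _ => 1) hb fun x hx => by simp [sign_pos hx.1]]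
    simp
  have hab : ∀ a ≤ 0, ∀ b ≥ 0, ∫ y in a..b, ((SignType.sign y : SignType) : ℝ) = a + b :=
    fun a ha b hb => by
      rw [← intervalIntegral.integral_add_adjacent_intervals (hi a 0) (hi 0 b), hneg a ha,
        hpos b hb]
  have hc' := abs_le.1 hc
  have hi' : IntervalIntegrable (fun y : ℝ => ((SignType.sign (y + c) : SignType) : ℝ))
      volume (-1) 1 :=
    intervalIntegrable_of_bounded (measurable_sign_real.comp (measurable_add_const c))
      (fun x => abs_sign_le_one _) _ _
  rw [intervalIntegral.integral_sub hi' (hi _ _),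
    intervalIntegral.integral_comp_add_right (fun y => ((SignType.sign y : SignType) : ℝ)),
    hab _ (by linarith) _ (by linarith), hab _ (by linarith) _ (by linarith)]
  ring

theorem measurable_levelModel (R : ℝ) {β : ℝ → ℝ} (hβ : Measurable β) (ρ : ℝ) :
    Measurable (levelModel R β ρ) := by
  have h1 := Complex.measurable_re
  have h2 := Complex.measurable_im
  refine Measurable.ite ?_ ?_ measurable_const
  · exact (measurableSet_le h1.abs measurable_const).inter (measurableSet_le h2.abs measurable_const)
  · exact (measurable_sign_real.comp (h2.add ((hβ.comp h1).const_mul ρ))).sub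
      (measurable_sign_real.comp h2)

theorem abs_levelModel_le (R : ℝ) (β : ℝ → ℝ) (ρ : ℝ) (z : ℂ) : |levelModel R β ρ z| ≤ 2 := by
  rw [levelModel]
  split_ifs
  · refine (abs_sub _ _).trans ?_
    linarith [abs_sign_le_one (z.im + ρ * β z.re), abs_sign_le_one z.im]
  · simp

theorem integral_levelModel {R : ℝ} (hR : 0 ≤ R) {β : ℝ → ℝ} (hβ : Measurable β) {ρ : ℝ}
    (hρ : ∀ x, |x| ≤ R → |ρ * β x| ≤ 1) :
    ∫ z, levelModel R β ρ z = 2 * ρ * ∫ x in (-R)..R, β x := by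
  have hmp := Complex.volume_preserving_equiv_real_prod.symm
  rw [← hmp.integral_comp' (g := levelModel R β ρ)]
  have hmeas : Measurable fun p => levelModel R β ρ (Complex.measurableEquivRealProd.symm p) :=
    (measurable_levelModel R hβ ρ).comp hmp.measurable
  have hsupp : ∀ p ∉ Icc (-R) R ×ˢ Icc (-1 : ℝ) 1,
      levelModel R β ρ (Complex.measurableEquivRealProd.symm p) = 0 := fun p hp => by
    rw [levelModel, if_neg fun h => hp ⟨abs_le.1 h.1, abs_le.1 h.2⟩]
  rw [← setIntegral_eq_integral_of_forall_compl_eq_zero hsupp, Measure.volume_eq_prod,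
    setIntegral_prod]
  · rw [← intervalIntegral.integral_const_mul, intervalIntegral.integral_of_le (by linarith),
      ← integral_Icc_eq_integral_Ioc]
    refine setIntegral_congr_fun measurableSet_Icc fun x hx => ?_
    have hx' : |x| ≤ R := abs_le.2 hx
    rw [mul_assoc, ← integral_sign_shift_sub (hρ x hx'), integral_Icc_eq_integral_Ioc,
      ← intervalIntegral.integral_of_le (by norm_num)]
    refine intervalIntegral.integral_congr fun y hy => ?_
    rw [uIcc_of_le (by norm_num)] at hy
    have : |x| ≤ R ∧ |y| ≤ 1 := ⟨hx', abs_le.2 hy⟩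
    change levelModel R β ρ ⟨x, y⟩ = _
    rw [levelModel, if_pos this]
  · refine Measure.integrableOn_of_bounded (M := 2) ?_ hmeas.aestronglyMeasurable
      (Eventually.of_forall fun p => ?_)
    · rw [Measure.prod_prod]
      simp [Real.volume_Icc, ENNReal.mul_eq_top]
    · exact abs_levelModel_le R β ρ _

theorem measurable_shapeModel (s α : ℝ) {h : ℂ → ℝ} (hh : Measurable h) (ρ : ℝ) :
    Measurable (shapeModel s α h ρ) :=
  Measurable.ite (measurableSet_le (continuous_amoebaNorm s α).measurable
      (((measurable_normPert s α hh).const_mul ρ).const_sub 1))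
    (measurable_sign_real.comp Complex.measurable_im) measurable_const

theorem abs_shapeModel_le (s α : ℝ) (h : ℂ → ℝ) (ρ : ℝ) (z : ℂ) : |shapeModel s α h ρ z| ≤ 1 := by
  rw [shapeModel]
  split_ifs
  · exact abs_sign_le_one _
  · simp

theorem shapeModel_eq_zero {s α : ℝ} {h : ℂ → ℝ} {H ρ : ℝ} (hH : ∀ z, |h z| ≤ H * ‖z‖ ^ 2)
    (hρ : 0 ≤ ρ) (hρH : ρ * H ≤ 1 / 2) {z : ℂ} (hz : 2 < ‖z‖) : shapeModel s α h ρ z = 0 := by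
  have h1 := norm_le_amoebaNorm s α z
  have h2 := (abs_le.1 (abs_normPert_le s α hH z)).1
  rw [shapeModel, if_neg]
  nlinarith

theorem exp_sub_pi_mul_I (θ : ℝ) :
    Complex.exp ((θ - π : ℝ) * Complex.I) = -Complex.exp (θ * Complex.I) := by
  push_cast
  rw [sub_mul, Complex.exp_sub_pi_mul_I]

/-- In polar coordinates the model amoeba is exactly r ≤ (1 − ρκ)/N on each ray. Pairing opposite
rays leaves ((1 − ρκ)² − (1 + ρκ)²)/(2N²) = −2ρκ/N², with no remainder. -/
theorem integral_shapeModel (s α : ℝ) {h : ℂ → ℝ} (hm : Measurable h)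
    (hh : ∀ (t : ℝ) z, h (t • z) = t ^ 2 * h z) {H : ℝ} (hH : ∀ z, |h z| ≤ H * ‖z‖ ^ 2)
    {ρ : ℝ} (hρ : 0 ≤ ρ) (hρH : ρ * H ≤ 1 / 2) :
    ∫ z, shapeModel s α h ρ z = -2 * ρ * ∫ θ in (0 : ℝ)..π,
      normPert s α h (Complex.exp (θ * Complex.I))
        / amoebaNorm s α (Complex.exp (θ * Complex.I)) ^ 2 := by
  set e : ℝ → ℂ := fun θ => Complex.exp (θ * Complex.I) with he
  have hem : Measurable e := by fun_prop
  set ν : ℝ → ℝ := fun θ => amoebaNorm s α (e θ) with hν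
  set κ : ℝ → ℝ := fun θ => normPert s α h (e θ) with hκ
  have hνm : Measurable ν := (continuous_amoebaNorm s α).measurable.comp hem
  have hκm : Measurable κ := (measurable_normPert s α hm).comp hem
  have hν1 : ∀ θ, 1 ≤ ν θ := fun θ => by
    have := norm_le_amoebaNorm s α (e θ)
    rwa [he, Complex.norm_exp_ofReal_mul_I] at this
  have hκH : ∀ θ, |ρ * κ θ| ≤ 1 / 2 := fun θ => by
    rw [abs_mul, abs_of_nonneg hρ]
    exact (mul_le_mul_of_nonneg_left (abs_normPert_le s α hH _) hρ).trans hρH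
  set c : ℝ → ℝ := fun θ => (1 - ρ * κ θ) / ν θ with hc
  have hcm : Measurable c := ((hκm.const_mul ρ).const_sub 1).div hνm
  have hc0 : ∀ θ, 0 ≤ c θ := fun θ => by
    have := (abs_le.1 (hκH θ)).2
    exact div_nonneg (by linarith) (by linarith [hν1 θ])
  have hc2 : ∀ θ, c θ ≤ 2 := fun θ => by
    have := (abs_le.1 (hκH θ)).1
    have h1 := hν1 θ
    simp only [hc]
    rw [div_le_iff₀ (by linarith)]
    linarith
  have hpolar : ∀ p : ℝ × ℝ, Complex.polarCoord.symm p = p.1 • e p.2 := fun p => by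
    simp only [Complex.polarCoord_symm_apply, he, Complex.exp_mul_I, Complex.real_smul,
      Complex.ofReal_cos, Complex.ofReal_sin]
  have hem' : Measurable fun p : ℝ × ℝ => p.1 • e p.2 :=
    measurable_fst.smul (hem.comp measurable_snd)
  have hfm : Measurable fun p : ℝ × ℝ => p.1 • shapeModel s α h ρ (p.1 • e p.2) :=
    measurable_fst.smul ((measurable_shapeModel s α hm ρ).comp hem')
  rw [← Complex.integral_comp_polarCoord_symm]
  simp only [hpolar]
  have hsub : Ioc (0 : ℝ) 2 ×ˢ Ioo (-π) π ⊆ polarCoord.target :=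
    prod_mono Ioc_subset_Ioi_self Subset.rfl
  rw [setIntegral_eq_of_subset_of_forall_sdiff_eq_zero
    polarCoord.open_target.measurableSet hsub, Measure.volume_eq_prod, ← Measure.prod_restrict,
    integral_prod_symm]
  · have hinner : ∀ θ, ∫ r in Ioc (0 : ℝ) 2, r • shapeModel s α h ρ (r • e θ)
        = SignType.sign (sin θ) * (c θ ^ 2 / 2) := fun θ => by
      have h1 : ∀ r ∈ Ioc (0 : ℝ) 2, r • shapeModel s α h ρ (r • e θ)
          = (Ioc 0 (c θ)).indicator (fun r => SignType.sign (sin θ) * r) r := by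
        intro r hr
        have him : SignType.sign (r • e θ).im = SignType.sign (sin θ) := by
          rw [Complex.smul_im, smul_eq_mul, he, Complex.exp_ofReal_mul_I_im, sign_mul,
            sign_pos hr.1, one_mul]
        have hcond : (amoebaNorm s α (r • e θ) ≤ 1 - ρ * normPert s α h (r • e θ))
            ↔ r ∈ Ioc 0 (c θ) := by
          rw [amoebaNorm_smul s α hr.1.le, normPert_smul s α hh hr.1, mem_Ioc,
            le_div_iff₀ (by linarith [hν1 θ])]
          exact ⟨fun h => ⟨hr.1, h⟩, fun h => h.2⟩
        rw [shapeModel, him, smul_eq_mul]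
        by_cases hr' : r ∈ Ioc 0 (c θ)
        · rw [if_pos (hcond.2 hr'), indicator_of_mem hr', mul_comm]
        · rw [if_neg (fun h => hr' (hcond.1 h)), indicator_of_notMem hr', mul_zero]
      rw [setIntegral_congr_fun measurableSet_Ioc h1, setIntegral_indicator measurableSet_Ioc,
        inter_eq_right.2 (Ioc_subset_Ioc_right (hc2 θ)),
        ← intervalIntegral.integral_of_le (hc0 θ), intervalIntegral.integral_const_mul, integral_id]
      ring
    simp only [hinner]
    have hqi : ∀ a b, IntervalIntegrable (fun θ => ((SignType.sign (sin θ) : SignType) : ℝ)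
        * (c θ ^ 2 / 2)) volume a b :=
      intervalIntegrable_of_bounded (C := 2)
        ((measurable_sign_real.comp measurable_sin).mul ((hcm.pow_const 2).div_const 2))
        (fun θ => by
          rw [abs_mul, abs_of_nonneg (show 0 ≤ c θ ^ 2 / 2 by positivity)]
          have h1 := abs_sign_le_one (sin θ)
          have h2 : c θ ^ 2 / 2 ≤ 2 := by nlinarith [hc0 θ, hc2 θ]
          calc _ ≤ 1 * (2 : ℝ) := mul_le_mul h1 h2 (by positivity) zero_le_one
            _ = 2 := one_mul 2)
    rw [← integral_Ioc_eq_integral_Ioo, ← intervalIntegral.integral_of_le (by linarith [pi_pos]),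
      ← intervalIntegral.integral_add_adjacent_intervals (hqi (-π) 0) (hqi 0 π)]
    -- The lower half-plane is shifted by π onto the upper one: the sign of Im z and κ both change,
    -- N does not.
    have hleft : ∫ θ in (-π)..0, ((SignType.sign (sin θ) : SignType) : ℝ) * (c θ ^ 2 / 2)
        = ∫ θ in 0..π, -(((1 + ρ * κ θ) / ν θ) ^ 2 / 2) := by
      rw [show (∫ θ in (-π)..0, ((SignType.sign (sin θ) : SignType) : ℝ) * (c θ ^ 2 / 2))
        = ∫ θ in (0 - π)..(π - π), ((SignType.sign (sin θ) : SignType) : ℝ) * (c θ ^ 2 / 2) by simp,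
        ← intervalIntegral.integral_comp_sub_right]
      refine intervalIntegral_congr_Ioo pi_pos.le fun θ hθ => ?_
      have h1 : SignType.sign (sin (θ - π)) = -1 := by
        rw [sin_sub_pi, sign_neg (neg_neg_of_pos (sin_pos_of_mem_Ioo hθ))]
      have h2 : c (θ - π) = (1 + ρ * κ θ) / ν θ := by
        simp only [hc, hκ, hν, he, exp_sub_pi_mul_I]
        rw [normPert_neg s α hh, ← neg_one_smul ℝ (Complex.exp _), amoebaNorm,
          linPart_smul, norm_smul, abs_mul, amoebaNorm]
        simp
      rw [h1, h2]
      simp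
    have hright : ∫ θ in 0..π, ((SignType.sign (sin θ) : SignType) : ℝ) * (c θ ^ 2 / 2)
        = ∫ θ in 0..π, c θ ^ 2 / 2 :=
      intervalIntegral_congr_Ioo pi_pos.le fun θ hθ => by
        simp [sign_pos (sin_pos_of_mem_Ioo hθ)]
    rw [hleft, hright, ← intervalIntegral.integral_add, ← intervalIntegral.integral_const_mul]
    · refine intervalIntegral.integral_congr fun θ _ => ?_
      have := hν1 θ
      change -(((1 + ρ * κ θ) / ν θ) ^ 2 / 2) + ((1 - ρ * κ θ) / ν θ) ^ 2 / 2
        = -2 * ρ * (κ θ / ν θ ^ 2)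
      field_simp
      ring
    · refine intervalIntegrable_of_bounded (C := 2)
        (((((hκm.const_mul ρ).const_add 1).div hνm).pow_const 2).div_const 2).neg (fun θ => ?_) _ _
      have h1 := abs_le.1 (hκH θ)
      have h2 := hν1 θ
      have h3 : |(1 + ρ * κ θ) / ν θ| ≤ 2 := by
        rw [abs_div, abs_of_nonneg (by linarith : 0 ≤ ν θ), abs_of_nonneg (by linarith),
          div_le_iff₀ (by linarith)]
        linarith
      change |-(((1 + ρ * κ θ) / ν θ) ^ 2 / 2)| ≤ 2
      rw [abs_neg, abs_of_nonneg (by positivity), ← sq_abs]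
      nlinarith [abs_nonneg ((1 + ρ * κ θ) / ν θ)]
    · refine intervalIntegrable_of_bounded (C := 2) ((hcm.pow_const 2).div_const 2) (fun θ => ?_) _ _
      rw [abs_of_nonneg (by positivity)]
      nlinarith [hc0 θ, hc2 θ]
  · rw [Measure.prod_restrict]
    refine Measure.integrableOn_of_bounded (M := 2) ?_ hfm.aestronglyMeasurable
      ((ae_restrict_mem (measurableSet_Ioc.prod measurableSet_Ioo)).mono fun p hp => ?_)
    · rw [Measure.prod_prod]
      simp [ENNReal.mul_eq_top]
    · rw [norm_smul, norm_eq_abs, norm_eq_abs, abs_of_pos hp.1.1]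
      have := abs_shapeModel_le s α h ρ (p.1 • e p.2)
      have := hp.1.2
      nlinarith [hp.1.1]
  · rintro p ⟨hp1, hp2⟩
    have h2 : 2 < p.1 := by
      by_contra hcon
      exact hp2 ⟨⟨hp1.1, not_lt.1 hcon⟩, hp1.2⟩
    rw [shapeModel_eq_zero hH hρ hρH, smul_zero]
    rw [norm_smul, he, Complex.norm_exp_ofReal_mul_I, mul_one, norm_eq_abs]
    exact h2.trans_le (le_abs_self _)

/-! ### The area balance to first order. -/

theorem integrable_of_bounded_of_support {f : ℂ → ℝ} (hf : Measurable f) {C : ℝ}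
    (hC : ∀ z, |f z| ≤ C) (hsupp : ∀ z, 2 < ‖z‖ → f z = 0) : Integrable f := by
  rw [← integrableOn_iff_integrable_of_support_subset (s := Metric.closedBall (0 : ℂ) 2)]
  · exact Measure.integrableOn_of_bounded (M := C)
      (measure_closedBall_lt_top (x := (0 : ℂ))).ne hf.aestronglyMeasurable (Eventually.of_forall hC)
  · intro z hz
    rw [mem_closedBall_zero_iff]
    exact not_lt.1 fun h => hz (hsupp z h)

theorem levelModel_eq_zero {R : ℝ} (hR : R ≤ 1) (β : ℝ → ℝ) (ρ : ℝ) {z : ℂ} (hz : 2 < ‖z‖) :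
    levelModel R β ρ z = 0 := by
  rw [levelModel, if_neg]
  intro h
  linarith [Complex.norm_le_abs_re_add_abs_im z, h.1, h.2]

theorem signOnAmoeba_eq_indicator (F V : ℂ → ℝ) (z : ℂ) :
    signOnAmoeba F V z = {z | ‖z‖ + |F z| ≤ 1 ∧ 0 < V z}.indicator 1 z
      - {z | ‖z‖ + |F z| ≤ 1 ∧ V z < 0}.indicator 1 z := by
  simp only [signOnAmoeba, indicator, mem_ofPred_eq, Pi.one_apply]
  by_cases hS : ‖z‖ + |F z| ≤ 1
  · rcases lt_trichotomy (V z) 0 with h | h | h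
    · simp [hS, h, h.not_gt]
    · simp [hS, h]
    · simp [hS, h, h.not_gt]
  · simp [hS]

theorem volume_amoeba_ne_top {F : ℂ → ℝ} {S : Set ℂ} (hS : S ⊆ {z | ‖z‖ + |F z| ≤ 1}) :
    volume S ≠ ⊤ := by
  refine ((measure_mono fun z hz => ?_).trans_lt
    (measure_closedBall_lt_top (x := (0 : ℂ)) (r := 1))).ne
  rw [mem_closedBall_zero_iff]
  have : ‖z‖ + |F z| ≤ 1 := hS hz
  linarith [abs_nonneg (F z)]

theorem integrable_indicator_amoeba {F : ℂ → ℝ} {S : Set ℂ} (hS : S ⊆ {z | ‖z‖ + |F z| ≤ 1})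
    (hm : MeasurableSet S) : Integrable (S.indicator (1 : ℂ → ℝ)) :=
  (integrable_indicator_iff hm).2 (integrableOn_const (volume_amoeba_ne_top hS))

theorem integral_signOnAmoeba {F V : ℂ → ℝ}
    (hpos : MeasurableSet {z | ‖z‖ + |F z| ≤ 1 ∧ 0 < V z})
    (hneg : MeasurableSet {z | ‖z‖ + |F z| ≤ 1 ∧ V z < 0}) :
    Integrable (signOnAmoeba F V) ∧
    ∫ z, signOnAmoeba F V z = volume.real {z | ‖z‖ + |F z| ≤ 1 ∧ 0 < V z}
      - volume.real {z | ‖z‖ + |F z| ≤ 1 ∧ V z < 0} := by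
  have h1 := integrable_indicator_amoeba (F := F) (fun z hz => hz.1) hpos
  have h2 := integrable_indicator_amoeba (F := F) (fun z hz => hz.1) hneg
  have he : signOnAmoeba F V = fun z => {z | ‖z‖ + |F z| ≤ 1 ∧ 0 < V z}.indicator (1 : ℂ → ℝ) z
      - {z | ‖z‖ + |F z| ≤ 1 ∧ V z < 0}.indicator (1 : ℂ → ℝ) z :=
    funext (signOnAmoeba_eq_indicator F V)
  rw [he]
  exact ⟨h1.sub h2, by rw [integral_sub h1 h2, integral_indicator_one hpos,
    integral_indicator_one hneg]⟩

theorem abs_signOnAmoeba_le (F V : ℂ → ℝ) (z : ℂ) : |signOnAmoeba F V z| ≤ 1 := by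
  rw [signOnAmoeba]
  split_ifs
  · exact abs_sign_le_one _
  · simp

/-- By homogeneity b restricted to the real axis is x² b(1), so the integral reduces to that of a
quadratic polynomial over [−R, R]. -/
theorem integral_levelModel_quadratic {s α w k K B ρ : ℝ} {b : ℂ → ℝ} (hb : Continuous b)
    (hbh : ∀ (t : ℝ) z, b (t • z) = t ^ 2 * b z) (hB : ∀ z, |b z| ≤ B * ‖z‖ ^ 2) (hw : 0 < w)
    (hk : |k| ≤ K) (hρ : 0 ≤ ρ) (hρC : ρ * ((B + K) / w) ≤ 1) :
    ∫ z, levelModel (1 / amoebaNorm s α 1) (fun x => (b x - k) / w) ρ z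
      = ρ * (4 * ((1 / amoebaNorm s α 1) ^ 3 * b 1 / 3 - 1 / amoebaNorm s α 1 * k) / w) := by
  have hB0 : 0 ≤ B := by simpa using (abs_nonneg _).trans (hB 1)
  have hN1 := one_le_amoebaNorm_one s α
  have hR1 : 1 / amoebaNorm s α 1 ≤ 1 := by
    rw [div_le_one (by linarith)]
    exact hN1
  rw [integral_levelModel (by positivity)]
  · have : ∀ x : ℝ, (b x - k) / w = x ^ 2 * (b 1 / w) - k / w := fun x => by
      have := hbh x 1
      rw [Complex.real_smul, mul_one] at this
      rw [this]
      ring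
    simp only [this]
    rw [intervalIntegral.integral_sub
      ((by fun_prop : Continuous fun x : ℝ => x ^ 2 * (b 1 / w)).intervalIntegrable _ _)
      intervalIntegrable_const,
      intervalIntegral.integral_mul_const, integral_pow, intervalIntegral.integral_const]
    norm_num
    ring
  · exact (by fun_prop : Continuous fun x : ℝ => (b x - k) / w).measurable
  · intro x hx
    refine le_trans ?_ hρC
    rw [abs_mul, abs_of_nonneg hρ, abs_div, abs_of_pos hw]
    gcongr
    refine (abs_sub _ _).trans (add_le_add ((hB x).trans (mul_le_of_le_one_right hB0
      (pow_le_one₀ (norm_nonneg _) ?_))) hk)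
    rw [Complex.norm_real, norm_eq_abs]
    exact hx.trans hR1

/-- The area balance on the rescaled amoeba, up to second order. -/
theorem exists_area_balance_le {s α H M w B L K : ℝ} {h b : ℂ → ℝ} (hs : 0 < s)
    (hm : Measurable h) (hh : ∀ (t : ℝ) z, h (t • z) = t ^ 2 * h z)
    (hH : ∀ z, |h z| ≤ H * ‖z‖ ^ 2) (hM : 0 < M) (hw : 0 < w) (hb : Continuous b)
    (hbh : ∀ (t : ℝ) z, b (t • z) = t ^ 2 * b z) (hB : ∀ z, |b z| ≤ B * ‖z‖ ^ 2) (hL : 0 ≤ L)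
    (hbL : ∀ z : ℂ, ‖z‖ ≤ 1 → |b z - b z.re| ≤ L * |z.im|) (hK : 0 ≤ K) :
    ∃ C ρ₀ : ℝ, 0 ≤ C ∧ 0 < ρ₀ ∧ ∀ ρ k : ℝ, ∀ F V : ℂ → ℝ, 0 < ρ → ρ ≤ ρ₀ → |k| ≤ K →
      MeasurableSet {z | ‖z‖ + |F z| ≤ 1 ∧ 0 < V z} →
      MeasurableSet {z | ‖z‖ + |F z| ≤ 1 ∧ V z < 0} →
      (∀ z, ‖z‖ ≤ 1 → |F z - (linPart s α z + ρ * h z)| ≤ M * ρ ^ 2) →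
      (∀ z, ‖z‖ ≤ 1 → |V z - (w * z.im + ρ * (b z - k))| ≤ M * ρ ^ 2) →
      |volume.real {z | ‖z‖ + |F z| ≤ 1 ∧ 0 < V z} - volume.real {z | ‖z‖ + |F z| ≤ 1 ∧ V z < 0}
        - ρ * (4 * ((1 / amoebaNorm s α 1) ^ 3 * b 1 / 3 - 1 / amoebaNorm s α 1 * k) / w
          - 2 * ∫ θ in (0 : ℝ)..π, normPert s α h (Complex.exp (θ * Complex.I))
            / amoebaNorm s α (Complex.exp (θ * Complex.I)) ^ 2)| ≤ C * ρ ^ 2 := by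
  have hH0 : 0 ≤ H := by simpa using (abs_nonneg _).trans (hH 1)
  have hB0 : 0 ≤ B := by simpa using (abs_nonneg _).trans (hB 1)
  set C₁ := (B + K + M) / w with hC₁
  set C₂ := (1 + s) * C₁ + H with hC₂
  set C₃ := (M + L * C₁) / w with hC₃
  set C₄ := 2 * (H ^ 2 * (2 + s) + M) with hC₄
  set C₅ := H + M with hC₅
  have hC₁0 : 0 ≤ C₁ := by positivity
  have hC₂0 : 0 ≤ C₂ := by positivity
  have hC₃0 : 0 ≤ C₃ := by positivity
  have hC₄0 : 0 < C₄ := by positivity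
  have hC₅0 : 0 < C₅ := by positivity
  set D := 8 * C₁ * C₂ + 4 * C₃ + 48 * π * C₄ + 8 * (C₅ / s) * (2 * C₅ + C₅ / s) with hD
  have hD0 : 0 ≤ D := by positivity
  -- The four summands of the denominator give, in order, ρ ≤ 1, ρH(2 + s) ≤ 1/2, ρC₁ ≤ 1, and, with
  -- ρ ≤ 1, C₄ρ² ≤ 1/6.
  set ρ₀ := 1 / (1 + 2 * (H * (2 + s)) + C₁ + 6 * C₄) with hρ₀
  have hden : 0 < 1 + 2 * (H * (2 + s)) + C₁ + 6 * C₄ := by positivity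
  refine ⟨4 * D, ρ₀, by positivity, by positivity, ?_⟩
  intro ρ k F V hρ hρρ₀ hk hSpos hSneg hF hV
  have hρden : ρ * (1 + 2 * (H * (2 + s)) + C₁ + 6 * C₄) ≤ 1 := by
    rwa [hρ₀, le_div_iff₀ hden] at hρρ₀
  have hp1 : 0 ≤ ρ * (H * (2 + s)) := by positivity
  have hp2 : 0 ≤ ρ * C₁ := by positivity
  have hp3 : 0 ≤ ρ * C₄ := by positivity
  have hρ1 : ρ ≤ 1 := by linarith
  have hρHs : ρ * (H * (2 + s)) ≤ 1 / 2 := by linarith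
  have hρH : ρ * H ≤ 1 / 2 := by
    have : 0 ≤ ρ * H * (1 + s) := by positivity
    linarith
  have hρC₁ : ρ * C₁ ≤ 1 := by linarith
  have hρC₄ : C₄ * ρ ^ 2 ≤ 1 / 6 := by nlinarith
  have hN1 := one_le_amoebaNorm_one s α
  have hR1 : 1 / amoebaNorm s α 1 ≤ 1 := by
    rw [div_le_one (by linarith)]
    exact hN1
  set β : ℝ → ℝ := fun x => (b x - k) / w with hβ
  have hβm : Measurable β := (by fun_prop : Continuous fun x : ℝ => (b x - k) / w).measurable
  -- The first and last sets have two dimensions of order ρ; the middle two have one dimension of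
  -- order ρ². Each has area O(ρ²).
  set T : Set ℂ := (({z | |z.im| ≤ C₁ * ρ ∧ |(|z.re| - 1 / amoebaNorm s α 1)| ≤ C₂ * ρ}
    ∪ {z | |z.im + ρ * β z.re| ≤ C₃ * ρ ^ 2 ∧ |z.re| ≤ 1})
    ∪ {z | |amoebaNorm s α z - 1 + ρ * normPert s α h z| ≤ C₄ * ρ ^ 2})
    ∪ {z | |linPart s α z| ≤ C₅ * ρ ∧ |amoebaNorm s α z - 1| ≤ C₅ * ρ} with hT
  have hTvol : volume T ≤ ENNReal.ofReal (D * ρ ^ 2) := by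
    have e : D * ρ ^ 2 = 8 * (C₁ * ρ) * (C₂ * ρ) + 4 * (C₃ * ρ ^ 2) + 48 * π * (C₄ * ρ ^ 2)
        + 8 * (C₅ * ρ / s) * (2 * (C₅ * ρ) + C₅ * ρ / s) := by
      rw [hD]
      ring
    rw [e, ENNReal.ofReal_add (by positivity) (by positivity),
      ENNReal.ofReal_add (by positivity) (by positivity),
      ENNReal.ofReal_add (by positivity) (by positivity)]
    refine (measure_union_le _ _).trans (add_le_add ((measure_union_le _ _).trans (add_le_add
      ((measure_union_le _ _).trans (add_le_add ?_ ?_)) ?_)) ?_)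
    · exact volume_box_le _ (by positivity)
    · exact volume_graph_strip_le (hβm.const_mul ρ) (by positivity)
    · exact volume_amoebaNorm_band_le s α hm hh hH hρ.le hρH (by positivity) hρC₄
    · exact volume_strip_inter_band_le hs α (by positivity)
  obtain ⟨hint, hval⟩ := integral_signOnAmoeba hSpos hSneg
  have hPint : Integrable (shapeModel s α h ρ) :=
    integrable_of_bounded_of_support (measurable_shapeModel s α hm ρ) (abs_shapeModel_le s α h ρ)
      fun z hz => shapeModel_eq_zero hH hρ.le hρH hz
  have hQint : Integrable (levelModel (1 / amoebaNorm s α 1) β ρ) :=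
    integrable_of_bounded_of_support (measurable_levelModel _ hβm ρ) (abs_levelModel_le _ β ρ)
      fun z hz => levelModel_eq_zero hR1 β ρ hz
  set Δ : ℂ → ℝ := fun z => signOnAmoeba F V z
    - (shapeModel s α h ρ z + levelModel (1 / amoebaNorm s α 1) β ρ z) with hΔ
  have hΔ0 : ∀ z ∉ T, Δ z = 0 := by
    intro z hz
    simp only [hT, mem_union, not_or] at hz
    obtain ⟨⟨⟨h1, h2⟩, h3⟩, h4⟩ := hz
    exact sub_eq_zero.2 (signOnAmoeba_eq hs.le hH hM.le hw hB hL (hbL z) hk (hF z) (hV z) hρ hρ1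
      hρHs hρC₁ h1 h2 h3 h4)
  have hΔint : |∫ z, Δ z| ≤ 4 * D * ρ ^ 2 := by
    rw [← setIntegral_eq_integral_of_forall_compl_eq_zero hΔ0, ← norm_eq_abs]
    -- 4 = 1 + 1 + 2, from the bounds on the sign function and on the two models.
    refine (norm_setIntegral_le_of_norm_le_const (C := 4)
      (hTvol.trans_lt ENNReal.ofReal_lt_top) fun z _ => ?_).trans ?_
    · rw [norm_eq_abs]
      refine (abs_sub _ _).trans ?_
      have h1 := abs_signOnAmoeba_le F V z
      have h2 := abs_shapeModel_le s α h ρ z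
      have h3 := abs_levelModel_le (1 / amoebaNorm s α 1) β ρ z
      have h4 := abs_add_le (shapeModel s α h ρ z) (levelModel (1 / amoebaNorm s α 1) β ρ z)
      linarith
    · rw [mul_assoc]
      gcongr
      exact ENNReal.toReal_le_of_le_ofReal (by positivity) hTvol
  have hsum : ∫ z, Δ z = volume.real {z | ‖z‖ + |F z| ≤ 1 ∧ 0 < V z}
      - volume.real {z | ‖z‖ + |F z| ≤ 1 ∧ V z < 0}
      - ρ * (4 * ((1 / amoebaNorm s α 1) ^ 3 * b 1 / 3 - 1 / amoebaNorm s α 1 * k) / w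
          - 2 * ∫ θ in (0 : ℝ)..π, normPert s α h (Complex.exp (θ * Complex.I))
            / amoebaNorm s α (Complex.exp (θ * Complex.I)) ^ 2) := by
    have e := integral_sub hint (hPint.add hQint)
    have e' := integral_add hPint hQint
    simp only [Pi.add_apply] at e
    rw [hΔ, e, e', hval,
      integral_shapeModel s α hm hh hH hρ.le hρH,
      integral_levelModel_quadratic hb hbh hB hw hk hρ.le]
    · ring
    · refine le_trans ?_ hρC₁
      exact mul_le_mul_of_nonneg_left (div_le_div_of_nonneg_right (by linarith) hw.le) hρ.le
  rw [← hsum]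
  exact hΔint

/-! ### Taylor expansion. -/

/-- Second-order Taylor expansion with cubic remainder. -/
theorem exists_taylor_two_bound {E : Type*} [NormedAddCommGroup E] [NormedSpace ℝ E] {f : E → ℝ}
    {x : E} (hf : ContDiffAt ℝ ∞ f x) :
    ∃ C r : ℝ, 0 ≤ C ∧ 0 < r ∧ ∀ v, ‖v‖ ≤ r → ContDiffAt ℝ 1 f (x + v) ∧
      ‖fderiv ℝ f (x + v) - fderiv ℝ f x‖ ≤ C * ‖v‖ ∧
      |f (x + v) - f x - fderiv ℝ f x v - fderiv ℝ (fderiv ℝ f) x v v / 2| ≤ C * ‖v‖ ^ 3 := by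
  have hf1 : ContDiffAt ℝ 2 (fderiv ℝ f) x := hf.fderiv_right (by norm_cast)
  have hf2 : ContDiffAt ℝ 1 (fderiv ℝ (fderiv ℝ f)) x := hf1.fderiv_right (by norm_num)
  set f₂ := fderiv ℝ (fderiv ℝ f) x with hf₂
  have hsymm : IsSymmSndFDerivAt ℝ f x := hf.isSymmSndFDerivAt (by
    rw [minSmoothness_of_isRCLikeNormedField]
    exact WithTop.coe_le_coe.2 le_top)
  have hf0 : ContDiffAt ℝ 1 f x := hf.of_le (by norm_cast)
  obtain ⟨K, t, ht, hK⟩ := hf2.exists_lipschitzOnWith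
  have hev : ∀ᶠ y in 𝓝 x, y ∈ t ∧ ContDiffAt ℝ 1 f y ∧ ContDiffAt ℝ 1 (fderiv ℝ f) y := by
    filter_upwards [ht, hf0.eventually (by simp),
      (hf1.of_le one_le_two).eventually (by simp)] with y h1 h2 h3
    exact ⟨h1, h2, h3⟩
  obtain ⟨r, hr, hball⟩ := Metric.nhds_basis_closedBall.eventually_iff.1 hev
  have hD2 : ∀ R ≤ r, ∀ y ∈ Metric.closedBall x R, ‖fderiv ℝ (fderiv ℝ f) y - f₂‖ ≤ K * R := by
    intro R hR y hy
    have h1 := hK.norm_sub_le (hball (Metric.closedBall_subset_closedBall hR hy)).1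
      (hball (Metric.mem_closedBall_self hr.le)).1
    refine h1.trans ?_
    rw [← dist_eq_norm]
    gcongr
    exact hy
  have hD1 : ∀ R ≤ r, ∀ y ∈ Metric.closedBall x R,
      ‖fderiv ℝ f y - fderiv ℝ f x - f₂ (y - x)‖ ≤ K * R * R := by
    intro R hR y hy
    have hR0 : 0 ≤ R := dist_nonneg.trans hy
    have h1 := (convex_closedBall x R).norm_image_sub_le_of_norm_hasFDerivWithin_le' (𝕜 := ℝ)
      (f := fderiv ℝ f) (f' := fderiv ℝ (fderiv ℝ f)) (φ := f₂) (C := K * R)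
      (fun y hy => ((hball (Metric.closedBall_subset_closedBall hR hy)).2.2.differentiableAt
        (by simp)).hasFDerivAt.hasFDerivWithinAt) (hD2 R hR)
      (Metric.mem_closedBall_self hR0) hy
    refine h1.trans ?_
    rw [← dist_eq_norm]
    gcongr
    exact hy
  refine ⟨max K (K * r + ‖f₂‖), r, le_max_of_le_left K.2, hr, fun v hv => ?_⟩
  have hmem : x + v ∈ Metric.closedBall x ‖v‖ := by simp
  have hmemr : x + v ∈ Metric.closedBall x r := Metric.closedBall_subset_closedBall hv hmem
  refine ⟨(hball hmemr).2.1, ?_, ?_⟩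
  · have h1 := hD1 ‖v‖ hv _ hmem
    rw [add_sub_cancel_left] at h1
    calc ‖fderiv ℝ f (x + v) - fderiv ℝ f x‖
        = ‖(fderiv ℝ f (x + v) - fderiv ℝ f x - f₂ v) + f₂ v‖ := by rw [sub_add_cancel]
      _ ≤ K * ‖v‖ * ‖v‖ + ‖f₂‖ * ‖v‖ := (norm_add_le _ _).trans (add_le_add h1 (f₂.le_opNorm v))
      _ ≤ (K * r + ‖f₂‖) * ‖v‖ := by
        rw [add_mul]
        gcongr
      _ ≤ _ := by
        gcongr
        exact le_max_right _ _
  -- A second use of the mean value inequality: by symmetry of the second derivative, `g` has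
  -- derivative `fderiv ℝ f y - f₂ (y - x)`, whose deviation from `fderiv ℝ f x` is already known to
  -- be quadratic.
  · set g : E → ℝ := fun y => f y - f₂ (y - x) (y - x) / 2 with hg
    have hgd : ∀ y ∈ Metric.closedBall x ‖v‖,
        HasFDerivWithinAt g (fderiv ℝ f y - f₂ (y - x)) (Metric.closedBall x ‖v‖) y := by
      intro y hy
      have h1 := ((hball (Metric.closedBall_subset_closedBall hv hy)).2.1.differentiableAt
        (by simp)).hasFDerivAt
      have h0 : HasFDerivAt (fun y : E => y - x) (ContinuousLinearMap.id ℝ E) y :=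
        (hasFDerivAt_id y).sub_const x
      have h2 : HasFDerivAt (fun y => f₂ (y - x)) f₂ y := f₂.hasFDerivAt.comp y h0
      have h3 := (h2.clm_apply h0).mul_const (1 / 2 : ℝ)
      have h4 := (h1.sub h3).hasFDerivWithinAt (s := Metric.closedBall x ‖v‖)
      have hge : g = f - fun y => f₂ (y - x) (y - x) * (1 / 2) := by
        funext y
        simp only [hg, Pi.sub_apply]
        ring
      rw [hge]
      refine h4.congr_fderiv ?_
      ext w
      simp only [sub_apply, smul_apply, add_apply, ContinuousLinearMap.flip_apply, smul_eq_mul,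
        ContinuousLinearMap.comp_apply, ContinuousLinearMap.id_apply]
      rw [hsymm w (y - x)]
      ring
    have h1 := (convex_closedBall x ‖v‖).norm_image_sub_le_of_norm_hasFDerivWithin_le' (𝕜 := ℝ)
      (φ := fderiv ℝ f x) (C := K * ‖v‖ * ‖v‖) hgd
      (fun y hy => by
        rw [sub_right_comm]
        exact hD1 ‖v‖ hv y hy)
      (Metric.mem_closedBall_self (norm_nonneg v)) hmem
    simp only [hg, add_sub_cancel_left, sub_self, map_zero,
      zero_div, sub_zero, norm_eq_abs] at h1
    calc _ = |f (x + v) - f₂ v v / 2 - f x - fderiv ℝ f x v| := by ring_nf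
      _ ≤ K * ‖v‖ * ‖v‖ * ‖v‖ := h1
      _ = K * ‖v‖ ^ 3 := by ring
      _ ≤ _ := by
        gcongr
        exact le_max_left _ _

/-! ### Curves, segments and the amoeba distance. -/

/-- The amoeba length of a curve is at least the amoeba norm of its increments. -/
theorem norm_add_abs_le_amoebaLength {Ω : Set Plane} {f : Plane → ℝ} {p q : Plane}
    {γ : ℝ → Plane} (hf : ContDiffOn ℝ ∞ f Ω) (hγ : IsRegularCurve Ω p q γ) :
    ‖q - p‖ + |f q - f p| ≤ amoebaLength nuL1 f γ := by
  have hfγ : ContDiffOn ℝ 1 (f ∘ γ) (Icc 0 1) :=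
    (hf.of_le (by norm_cast)).comp hγ.contDiffOn hγ.mapsTo
  have huniq := uniqueDiffOn_Icc (zero_lt_one (α := ℝ))
  have hc1 := hγ.contDiffOn.continuousOn_derivWithin huniq le_rfl
  have hc2 := hfγ.continuousOn_derivWithin huniq le_rfl
  have h1 := intervalIntegral.integral_derivWithin_Icc_of_contDiffOn_Icc hγ.contDiffOn zero_le_one
  have h2 := intervalIntegral.integral_derivWithin_Icc_of_contDiffOn_Icc hfγ zero_le_one
  rw [hγ.source, hγ.target] at h1
  simp only [Function.comp_apply, hγ.source, hγ.target] at h2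
  have hi1 : IntervalIntegrable (fun t => ‖derivWithin γ (Icc 0 1) t‖) volume 0 1 :=
    ContinuousOn.intervalIntegrable (by rw [uIcc_of_le zero_le_one]; exact hc1.norm)
  have hi2 : IntervalIntegrable (fun t => |derivWithin (f ∘ γ) (Icc 0 1) t|) volume 0 1 :=
    ContinuousOn.intervalIntegrable (by rw [uIcc_of_le zero_le_one]; exact hc2.abs)
  -- Here the special form of ν enters: multiplied by the speed, 1 + |·| splits into the speed and
  -- |(f ∘ γ)'|.
  have hL : amoebaLength nuL1 f γ = (∫ t in (0 : ℝ)..1, ‖derivWithin γ (Icc 0 1) t‖)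
      + ∫ t in (0 : ℝ)..1, |derivWithin (f ∘ γ) (Icc 0 1) t| := by
    rw [← intervalIntegral.integral_add hi1 hi2, amoebaLength]
    refine intervalIntegral.integral_congr fun t ht => ?_
    rw [uIcc_of_le zero_le_one] at ht
    have h0 : 0 < ‖derivWithin γ (Icc 0 1) t‖ := norm_pos_iff.2 (hγ.velocity_ne_zero t ht)
    simp only [nuL1, abs_div, abs_norm]
    field_simp
  rw [hL]
  refine add_le_add ?_ ?_
  · rw [← h1]
    exact intervalIntegral.norm_integral_le_integral_norm zero_le_one
  · rw [← h2]
    exact intervalIntegral.abs_integral_le_integral_abs zero_le_one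

theorem norm_add_abs_le_of_mem_amoeba {Ω : Set Plane} {f : Plane → ℝ} {p q : Plane} {ρ : ℝ}
    (hf : ContDiffOn ℝ ∞ f Ω) (hρ : 0 ≤ ρ) (hq : q ∈ amoeba nuL1 Ω f ρ p) :
    ‖q - p‖ + |f q - f p| ≤ ρ := by
  rw [← ENNReal.ofReal_le_ofReal_iff hρ]
  refine le_trans ?_ hq.2
  exact le_iInf₂ fun γ hγ => ENNReal.ofReal_le_ofReal (norm_add_abs_le_amoebaLength hf hγ)

/-- The end point of a segment of amoeba length at most `ρ` lies in the amoeba. -/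
theorem mem_amoeba_of_segment {Ω : Set Plane} {f : Plane → ℝ} {p v : Plane} {ρ : ℝ} (hv : v ≠ 0)
    (hΩ : ∀ t ∈ Icc (0 : ℝ) 1, p + t • v ∈ Ω)
    (hf : ∀ t ∈ Icc (0 : ℝ) 1, ContDiffAt ℝ 1 f (p + t • v))
    (hlen : ‖v‖ + ∫ t in (0 : ℝ)..1, |fderiv ℝ f (p + t • v) v| ≤ ρ) :
    p + v ∈ amoeba nuL1 Ω f ρ p := by
  set γ : ℝ → Plane := fun t => p + t • v with hγdef
  have huniq := uniqueDiffOn_Icc (zero_lt_one (α := ℝ))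
  have hγd : ∀ t, HasDerivAt γ v t := fun t => by
    have h := ((hasDerivAt_id t).smul_const v).const_add p
    rwa [one_smul] at h
  have hγ' : ∀ t ∈ Icc (0 : ℝ) 1, derivWithin γ (Icc 0 1) t = v := fun t ht =>
    (hγd t).hasDerivWithinAt.derivWithin (huniq t ht)
  have hfγ' : ∀ t ∈ Icc (0 : ℝ) 1, derivWithin (f ∘ γ) (Icc 0 1) t = fderiv ℝ f (p + t • v) v :=
    fun t ht => (((hf t ht).differentiableAt (by simp)).hasFDerivAt.comp_hasDerivAt t
      (hγd t)).hasDerivWithinAt.derivWithin (huniq t ht)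
  have hreg : IsRegularCurve Ω p (p + v) γ :=
    { contDiffOn := by fun_prop
      velocity_ne_zero := fun t ht => by rw [hγ' t ht]; exact hv
      mapsTo := hΩ
      source := by simp [hγdef]
      target := by simp [hγdef] }
  have hcont : ContinuousOn (fun t : ℝ => |fderiv ℝ f (p + t • v) v|) (Icc 0 1) := by
    intro t ht
    have h1 : ContinuousAt (fderiv ℝ f) (p + t • v) :=
      ((hf t ht).fderiv_right (m := 0) (by simp)).continuousAt
    have h2 : ContinuousAt (fun t : ℝ => fderiv ℝ f (p + t • v)) t :=
      ContinuousAt.comp (f := γ) h1 (hγd t).continuousAt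
    exact (h2.clm_apply continuousAt_const).abs.continuousWithinAt
  refine ⟨by simpa using hΩ 1 (by simp), ?_⟩
  refine (iInf₂_le γ hreg).trans (ENNReal.ofReal_le_ofReal (le_trans (le_of_eq ?_) hlen))
  have hv0 : 0 < ‖v‖ := norm_pos_iff.2 hv
  calc amoebaLength nuL1 f γ
      = ∫ t in (0 : ℝ)..1, (‖v‖ + |fderiv ℝ f (p + t • v) v|) := by
        refine intervalIntegral.integral_congr fun t ht => ?_
        rw [uIcc_of_le zero_le_one] at ht
        simp only [hγ' t ht, hfγ' t ht, nuL1, abs_div, abs_norm]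
        field_simp
    _ = _ := by
        rw [intervalIntegral.integral_add intervalIntegrable_const
          (ContinuousOn.intervalIntegrable (by rwa [uIcc_of_le zero_le_one]))]
        simp

/-! ### Coordinates adapted to ∇u. -/

theorem dirVec_apply_zero (θ : ℝ) : dirVec θ 0 = cos θ := rfl

theorem dirVec_apply_one (θ : ℝ) : dirVec θ 1 = sin θ := rfl

theorem inner_dirVec (θ τ : ℝ) : inner ℝ (dirVec θ) (dirVec τ) = cos (τ - θ) := by
  rw [PiLp.inner_apply, Fin.sum_univ_two, dirVec_apply_zero, dirVec_apply_zero, dirVec_apply_one,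
    dirVec_apply_one, cos_sub]
  simp

/-- The isometry that takes the imaginary axis to the direction `ψ`. -/
noncomputable def planeIso (ψ : ℝ) : ℂ ≃ₗᵢ[ℝ] Plane :=
  (rotation (Circle.exp (ψ - π / 2))).trans Complex.orthonormalBasisOneI.repr

theorem planeIso_apply (ψ : ℝ) (z : ℂ) :
    planeIso ψ z = z.re • dirVec (ψ - π / 2) + z.im • dirVec ψ := by
  have h : planeIso ψ z = Complex.orthonormalBasisOneI.repr
      (Complex.exp ((ψ - π / 2 : ℝ) * Complex.I) * z) := by
    rw [planeIso, LinearIsometryEquiv.trans_apply, rotation_apply, Circle.coe_exp]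
  rw [h]
  ext i
  fin_cases i
  · simp [-Complex.ofReal_sub, dirVec, Complex.exp_ofReal_mul_I_re, Complex.exp_ofReal_mul_I_im,
      Complex.orthonormalBasisOneI_repr_apply, cos_sub_pi_div_two, sin_sub_pi_div_two]
    ring
  · simp [-Complex.ofReal_sub, dirVec, Complex.exp_ofReal_mul_I_re, Complex.exp_ofReal_mul_I_im,
      Complex.orthonormalBasisOneI_repr_apply, cos_sub_pi_div_two, sin_sub_pi_div_two]
    ring

theorem planeIso_exp (ψ θ : ℝ) :
    planeIso ψ (Complex.exp (θ * Complex.I)) = dirVec (θ + ψ - π / 2) := by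
  rw [planeIso_apply, Complex.exp_ofReal_mul_I_re, Complex.exp_ofReal_mul_I_im]
  ext i
  fin_cases i
  · simp [dirVec, cos_sub_pi_div_two, sin_sub_pi_div_two, sin_add]
    ring
  · simp [dirVec, cos_sub_pi_div_two, sin_sub_pi_div_two, cos_add]
    ring

theorem fderiv_apply_eq_inner (f : Plane → ℝ) (x v : Plane) :
    fderiv ℝ f x v = inner ℝ (gradient f x) v := by
  rw [gradient, InnerProductSpace.toDual_symm_apply]

theorem fderiv_planeIso {f : Plane → ℝ} {x : Plane} {φ : ℝ}
    (hf : gradient f x = ‖gradient f x‖ • dirVec φ) (α : ℝ) (z : ℂ) :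
    fderiv ℝ f x (planeIso (φ + α) z) = linPart ‖gradient f x‖ α z := by
  rw [fderiv_apply_eq_inner, hf, planeIso_apply, real_inner_smul_left, inner_add_right,
    real_inner_smul_right, real_inner_smul_right, inner_dirVec, inner_dirVec, ← hf, linPart,
    show φ + α - π / 2 - φ = α - π / 2 by ring, cos_sub_pi_div_two, add_sub_cancel_left]
  ring

/-- No measurability is asked of `X`, because it is applied to the amoeba, whose measurability is
never established. -/
theorem volume_eq_rescaled (ψ : ℝ) (x : Plane) {ρ : ℝ} (hρ : 0 < ρ) (X : Set Plane) :
    volume X = ENNReal.ofReal (ρ ^ 2) * volume {z | x + ρ • planeIso ψ z ∈ X} := by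
  have h1 : {z | x + ρ • planeIso ψ z ∈ X} = (planeIso ψ).toMeasurableEquiv ⁻¹'
      ((fun v : Plane => ρ • v) ⁻¹' ((fun v => x + v) ⁻¹' X)) := rfl
  rw [h1, (planeIso ψ).measurePreserving.measure_preimage_equiv
    (f := (planeIso ψ).toMeasurableEquiv), Measure.addHaar_preimage_smul _ hρ.ne',
    measure_preimage_add, finrank_euclideanSpace_fin, ← mul_assoc,
    ← ENNReal.ofReal_mul (by positivity), abs_of_pos (by positivity),
    mul_inv_cancel₀ (by positivity), ENNReal.ofReal_one, one_mul]

theorem measurableSet_sublevel_inter_of_continuousOn {F V : ℂ → ℝ}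
    (hF : ContinuousOn F (Metric.closedBall 0 1)) (hV : ContinuousOn V (Metric.closedBall 0 1))
    {t : Set ℝ} (ht : MeasurableSet t) : MeasurableSet {z | ‖z‖ + |F z| ≤ 1 ∧ V z ∈ t} := by
  have hB : MeasurableSet (Metric.closedBall (0 : ℂ) 1) := measurableSet_closedBall
  classical
  have hF' := hF.measurable_piecewise (continuousOn_const (c := (0 : ℝ))) hB
  have hV' := hV.measurable_piecewise (continuousOn_const (c := (0 : ℝ))) hB
  have : {z | ‖z‖ + |F z| ≤ 1 ∧ V z ∈ t} = Metric.closedBall 0 1 ∩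
      ({z | ‖z‖ + |(Metric.closedBall (0 : ℂ) 1).piecewise F (fun _ => 0) z| ≤ 1} ∩
        (Metric.closedBall (0 : ℂ) 1).piecewise V (fun _ => 0) ⁻¹' t) := by
    ext z
    by_cases hz : z ∈ Metric.closedBall (0 : ℂ) 1
    · simp only [mem_ofPred_eq, mem_inter_iff, mem_preimage, piecewise_eq_of_mem _ _ _ hz, hz,
        true_and]
    · simp only [hz, mem_inter_iff, false_and, iff_false, mem_ofPred_eq]
      intro h
      apply hz
      rw [mem_closedBall_zero_iff]
      linarith [h.1, abs_nonneg (F z)]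
  rw [this]
  exact hB.inter ((measurableSet_le (measurable_norm.add hF'.abs) measurable_const).inter
    (hV' ht))

/-! ### Segments as competitors. -/

/-- A point of the set `‖v‖ + |f (x + v) - f x| ≤ ρ` belongs to the amoeba, unless it lies in a thin
double cone and close to the boundary. -/
theorem mem_amoeba_or {Ω : Set Plane} {f : Plane → ℝ} {x v : Plane} {C ρ : ℝ} (hv : v ≠ 0)
    (hC : 0 ≤ C) (hΩ : ∀ t ∈ Icc (0 : ℝ) 1, x + t • v ∈ Ω)
    (hf : ∀ t ∈ Icc (0 : ℝ) 1, ContDiffAt ℝ 1 f (x + t • v) ∧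
      ‖fderiv ℝ f (x + t • v) - fderiv ℝ f x‖ ≤ C * ‖t • v‖)
    (hlen : ‖v‖ + |f (x + v) - f x| ≤ ρ) :
    x + v ∈ amoeba nuL1 Ω f ρ x ∨
      (|fderiv ℝ f x v| ≤ C * ‖v‖ ^ 2 ∧ ρ < ‖v‖ + 2 * C * ‖v‖ ^ 2) := by
  by_contra! hcon
  obtain ⟨hnot, himp⟩ := hcon
  have hder : ∀ t ∈ Icc (0 : ℝ) 1,
      |fderiv ℝ f (x + t • v) v - fderiv ℝ f x v| ≤ C * ‖v‖ ^ 2 := by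
    intro t ht
    calc _ = ‖(fderiv ℝ f (x + t • v) - fderiv ℝ f x) v‖ := by rw [sub_apply, norm_eq_abs]
      _ ≤ C * ‖t • v‖ * ‖v‖ := (ContinuousLinearMap.le_opNorm _ _).trans (by
          gcongr
          exact (hf t ht).2)
      _ ≤ C * (1 * ‖v‖) * ‖v‖ := by
          rw [norm_smul, norm_eq_abs, abs_of_nonneg ht.1]
          gcongr
          exact ht.2
      _ = _ := by ring
  set g : ℝ → ℝ := fun t => fderiv ℝ f (x + t • v) v with hg
  have hgcont : ContinuousOn g (Icc 0 1) := by
    intro t ht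
    have hd : HasDerivAt (fun t : ℝ => x + t • v) v t := by
      have h := ((hasDerivAt_id t).smul_const v).const_add x
      rwa [one_smul] at h
    have h1 : ContinuousAt (fderiv ℝ f) (x + t • v) :=
      ((hf t ht).1.fderiv_right (m := 0) (by simp)).continuousAt
    have h2 : ContinuousAt (fun t : ℝ => fderiv ℝ f (x + t • v)) t :=
      ContinuousAt.comp (f := fun t : ℝ => x + t • v) h1 hd.continuousAt
    exact (h2.clm_apply continuousAt_const).continuousWithinAt
  have hgi : IntervalIntegrable g volume 0 1 :=
    ContinuousOn.intervalIntegrable (by rwa [uIcc_of_le zero_le_one])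
  have hftc : ∫ t in (0 : ℝ)..1, g t = f (x + v) - f x := by
    rw [intervalIntegral.integral_eq_sub_of_hasDerivAt (f := fun t : ℝ => f (x + t • v))
      (fun t ht => ?_) hgi]
    · simp
    · rw [uIcc_of_le zero_le_one] at ht
      have hd : HasDerivAt (fun t : ℝ => x + t • v) v t := by
        have h := ((hasDerivAt_id t).smul_const v).const_add x
        rwa [one_smul] at h
      exact ((hf t ht).1.differentiableAt (by simp)).hasFDerivAt.comp_hasDerivAt t hd
  have hseg : ∀ L, (∫ t in (0 : ℝ)..1, |g t|) ≤ L → ρ < ‖v‖ + L := fun L hL => by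
    by_contra! h
    exact hnot (mem_amoeba_of_segment hv hΩ (fun t ht => (hf t ht).1)
      ((add_le_add_right hL _).trans h))
  have hmono : ∀ L : ℝ, (∀ t ∈ Icc (0 : ℝ) 1, |g t| ≤ L) → (∫ t in (0 : ℝ)..1, |g t|) ≤ L := by
    intro L hL
    calc (∫ t in (0 : ℝ)..1, |g t|) ≤ ∫ t in (0 : ℝ)..1, L :=
        intervalIntegral.integral_mono_on zero_le_one hgi.abs intervalIntegrable_const hL
      _ = L := by simp
  -- If the initial slope is small, the variation along the segment is at most 2C‖v‖², so only
  -- points close to the boundary can be missed. Otherwise `hder` keeps the slope of constant sign,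
  -- and the variation equals the increment of `f`.
  rcases le_or_gt |fderiv ℝ f x v| (C * ‖v‖ ^ 2) with h | h
  · have h1 := himp h
    have h2 := hseg (2 * C * ‖v‖ ^ 2) (hmono _ fun t ht => by
      have h3 := hder t ht
      have h4 := abs_sub_abs_le_abs_sub (g t) (fderiv ℝ f x v)
      linarith)
    linarith
  · have h2 : (∫ t in (0 : ℝ)..1, |g t|) = |f (x + v) - f x| := by
      rw [← hftc]
      rcases lt_abs.1 h with h | h
      · have hpos : ∀ t ∈ Icc (0 : ℝ) 1, 0 ≤ g t := fun t ht => by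
          have := (abs_le.1 (hder t ht)).1
          linarith
        rw [abs_of_nonneg (intervalIntegral.integral_nonneg zero_le_one hpos)]
        refine intervalIntegral.integral_congr fun t ht => abs_of_nonneg (hpos t ?_)
        rwa [uIcc_of_le zero_le_one] at ht
      · have hneg : ∀ t ∈ Icc (0 : ℝ) 1, g t ≤ 0 := fun t ht => by
          have := (abs_le.1 (hder t ht)).2
          linarith
        have he : (∫ t in (0 : ℝ)..1, |g t|) = -∫ t in (0 : ℝ)..1, g t := by
          rw [← intervalIntegral.integral_neg]
          refine intervalIntegral.integral_congr fun t ht => abs_of_nonpos (hneg t ?_)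
          rwa [uIcc_of_le zero_le_one] at ht
        rw [he, abs_of_nonpos]
        rw [← neg_nonneg, ← he]
        exact intervalIntegral.integral_nonneg zero_le_one fun t _ => abs_nonneg _
    have := hseg _ h2.le
    linarith

/-! ### Existence of medians. -/

/-- `A` need not be measurable: it is split along u < c by the measurable trace of this set on the
larger `B`. The median is the supremum of the levels below which at most half of `A` lies, by
continuity of the measure along increasing unions. -/
theorem exists_median {X : Type*} [MeasurableSpace X] (μ : Measure X) {A B : Set X} {u : X → ℝ}
    {M : ℝ} (hAB : A ⊆ B) (hA : μ A ≠ ⊤) (hu : ∀ x ∈ B, |u x| ≤ M)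
    (hB : ∀ c, MeasurableSet {x ∈ B | u x < c}) :
    ∃ m, μ {x ∈ A | u x < m} ≤ μ A / 2 ∧ μ {x ∈ A | m < u x} ≤ μ A / 2 := by
  rcases eq_or_ne (μ A) 0 with h0 | h0
  · refine ⟨0, ?_, ?_⟩ <;>
    · rw [measure_mono_null (sep_subset A _) h0]
      exact zero_le
  have hsplit : ∀ c, μ A = μ {x ∈ A | u x < c} + μ {x ∈ A | c ≤ u x} := by
    intro c
    rw [← measure_inter_add_sdiff A (hB c)]
    congr 2
    · ext x
      exact ⟨fun h => ⟨h.1, h.2.2⟩, fun h => ⟨h.1, hAB h.1, h.2⟩⟩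
    · ext x
      exact ⟨fun h => ⟨h.1, not_lt.1 fun hc => h.2 ⟨hAB h.1, hc⟩⟩,
        fun h => ⟨h.1, fun hc => h.2.not_gt hc.2⟩⟩
  set T : Set ℝ := {c | μ {x ∈ A | u x < c} ≤ μ A / 2} with hT
  have hTne : T.Nonempty := by
    refine ⟨-M, ?_⟩
    have : {x ∈ A | u x < -M} = ∅ := by
      ext x
      simp only [mem_ofPred_eq, mem_empty_iff_false, iff_false, not_and, not_lt]
      exact fun hx => (abs_le.1 (hu x (hAB hx))).1
    rw [hT, mem_ofPred_eq, this, measure_empty]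
    exact zero_le
  have hTbdd : BddAbove T := by
    refine ⟨M + 1, fun c hc => ?_⟩
    by_contra! hlt
    have : {x ∈ A | u x < c} = A := by
      ext x
      simp only [mem_ofPred_eq, and_iff_left_iff_imp]
      exact fun hx => by linarith [(abs_le.1 (hu x (hAB hx))).2]
    rw [hT, mem_ofPred_eq, this] at hc
    exact (ENNReal.half_lt_self h0 hA).not_ge hc
  refine ⟨sSup T, ?_, ?_⟩
  · have hU : {x ∈ A | u x < sSup T} = ⋃ n : ℕ, {x ∈ A | u x < sSup T - 1 / (n + 1)} := by
      ext x
      simp only [mem_ofPred_eq, mem_iUnion]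
      constructor
      · rintro ⟨hx, hlt⟩
        obtain ⟨n, hn⟩ := exists_nat_one_div_lt (sub_pos.2 hlt)
        exact ⟨n, hx, by linarith⟩
      · rintro ⟨n, hx, hlt⟩
        exact ⟨hx, hlt.trans (sub_lt_self _ Nat.one_div_pos_of_nat)⟩
    have hmono : Monotone fun n : ℕ => {x ∈ A | u x < sSup T - 1 / ((n : ℝ) + 1)} := by
      intro n k hnk x hx
      exact ⟨hx.1, hx.2.trans_le (sub_le_sub_left (Nat.one_div_le_one_div hnk) _)⟩
    rw [hU, hmono.measure_iUnion]
    refine iSup_le fun n => ?_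
    obtain ⟨c, hc, hlt⟩ := exists_lt_of_lt_csSup hTne
      (sub_lt_self (sSup T) (Nat.one_div_pos_of_nat (n := n)))
    have hsub : {x ∈ A | u x < sSup T - 1 / ((n : ℝ) + 1)} ⊆ {x ∈ A | u x < c} :=
      fun x hx => ⟨hx.1, hx.2.trans hlt⟩
    exact (measure_mono hsub).trans hc
  · have hU : {x ∈ A | sSup T < u x} = ⋃ n : ℕ, {x ∈ A | sSup T + 1 / (n + 1) ≤ u x} := by
      ext x
      simp only [mem_ofPred_eq, mem_iUnion]
      constructor
      · rintro ⟨hx, hlt⟩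
        obtain ⟨n, hn⟩ := exists_nat_one_div_lt (sub_pos.2 hlt)
        exact ⟨n, hx, by linarith⟩
      · rintro ⟨n, hx, hlt⟩
        exact ⟨hx, (lt_add_of_pos_right _ Nat.one_div_pos_of_nat).trans_le hlt⟩
    have hmono : Monotone fun n : ℕ => {x ∈ A | sSup T + 1 / ((n : ℝ) + 1) ≤ u x} := by
      intro n k hnk x hx
      exact ⟨hx.1, (add_le_add_right (Nat.one_div_le_one_div hnk) _).trans hx.2⟩
    rw [hU, hmono.measure_iUnion]
    refine iSup_le fun n => ?_
    have hnot : sSup T + 1 / ((n : ℝ) + 1) ∉ T := fun h =>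
      (lt_add_of_pos_right (sSup T) (Nat.one_div_pos_of_nat (n := n))).not_ge (le_csSup hTbdd h)
    have hgt : μ A / 2 < μ {x ∈ A | u x < sSup T + 1 / ((n : ℝ) + 1)} := not_le.1 hnot
    by_contra! hcon
    have := ENNReal.add_lt_add hgt hcon
    rw [ENNReal.add_halves, ← hsplit] at this
    exact lt_irrefl _ this

/-! ### Quadratic forms and the coefficients of the PDE. -/

/-- Half of the second derivative, in the coordinate system adapted to `∇u`. -/
noncomputable def quadPart (f : Plane → ℝ) (x : Plane) (ψ : ℝ) (z : ℂ) : ℝ :=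
  secondDeriv f x (planeIso ψ z) (planeIso ψ z) / 2

theorem continuous_quadPart (f : Plane → ℝ) (x : Plane) (ψ : ℝ) : Continuous (quadPart f x ψ) := by
  unfold quadPart secondDeriv
  fun_prop

theorem quadPart_smul (f : Plane → ℝ) (x : Plane) (ψ t : ℝ) (z : ℂ) :
    quadPart f x ψ (t • z) = t ^ 2 * quadPart f x ψ z := by
  rw [quadPart, quadPart, secondDeriv, secondDeriv, map_smul, map_smul, map_smul, smul_apply,
    smul_eq_mul, smul_eq_mul]
  ring

theorem abs_secondDeriv_le (f : Plane → ℝ) (x v w : Plane) :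
    |secondDeriv f x v w| ≤ ‖fderiv ℝ (fderiv ℝ f) x‖ * ‖v‖ * ‖w‖ := by
  rw [← norm_eq_abs]
  exact (fderiv ℝ (fderiv ℝ f) x).le_opNorm₂ v w

theorem abs_quadPart_le (f : Plane → ℝ) (x : Plane) (ψ : ℝ) (z : ℂ) :
    |quadPart f x ψ z| ≤ ‖fderiv ℝ (fderiv ℝ f) x‖ * ‖z‖ ^ 2 := by
  have h := abs_secondDeriv_le f x (planeIso ψ z) (planeIso ψ z)
  rw [LinearIsometryEquiv.norm_map] at h
  rw [quadPart, abs_div, abs_two, sq, ← mul_assoc]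
  linarith [abs_nonneg (secondDeriv f x (planeIso ψ z) (planeIso ψ z))]

theorem abs_quadPart_sub_le (f : Plane → ℝ) (x : Plane) (ψ : ℝ) {z : ℂ} (hz : ‖z‖ ≤ 1) :
    |quadPart f x ψ z - quadPart f x ψ z.re| ≤ ‖fderiv ℝ (fderiv ℝ f) x‖ * |z.im| := by
  obtain ⟨E, hE⟩ : ∃ E, E = planeIso ψ := ⟨_, rfl⟩
  set y : ℂ := z.im * Complex.I with hy
  have hzy : z = z.re + y := (Complex.re_add_im z).symm
  have hyn : ‖E y‖ = |z.im| := by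
    rw [LinearIsometryEquiv.norm_map, hy, norm_mul, Complex.norm_I, mul_one, Complex.norm_real,
      norm_eq_abs]
  have hren : ‖E (z.re : ℂ)‖ ≤ 1 := by
    rw [LinearIsometryEquiv.norm_map, Complex.norm_real, norm_eq_abs]
    exact (Complex.abs_re_le_norm z).trans hz
  have hzn : ‖E z‖ ≤ 1 := by rwa [LinearIsometryEquiv.norm_map]
  have hid : quadPart f x ψ z - quadPart f x ψ z.re
      = (secondDeriv f x (E y) (E z) + secondDeriv f x (E z.re) (E y)) / 2 := by
    have e : E z = E z.re + E y := by
      rw [← map_add, ← hzy]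
    simp only [quadPart, secondDeriv, ← hE, e, map_add, add_apply]
    ring
  have h1 := abs_secondDeriv_le f x (E y) (E z)
  have h2 := abs_secondDeriv_le f x (E z.re) (E y)
  rw [hyn] at h1 h2
  set Q := ‖fderiv ℝ (fderiv ℝ f) x‖
  have hQ : 0 ≤ Q * |z.im| := by positivity
  have h3 : Q * |z.im| * ‖E z‖ ≤ Q * |z.im| := mul_le_of_le_one_right hQ hzn
  have h4 : Q * ‖E (z.re : ℂ)‖ * |z.im| ≤ Q * |z.im| := by
    rw [mul_right_comm]
    exact mul_le_of_le_one_right hQ hren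
  rw [hid, abs_div, abs_two]
  have := abs_add_le (secondDeriv f x (E y) (E z)) (secondDeriv f x (E z.re) (E y))
  linarith

/-- The coordinate vector 1 is mapped to −ξ; the sign is lost in the quadratic form. -/
theorem quadPart_one (f : Plane → ℝ) (x : Plane) (ψ : ℝ) :
    quadPart f x ψ 1 = secondDeriv f x (dirVec (ψ + π / 2)) (dirVec (ψ + π / 2)) / 2 := by
  have h : planeIso ψ 1 = -dirVec (ψ + π / 2) := by
    rw [planeIso_apply]
    ext i
    fin_cases i <;> simp [dirVec, cos_sub_pi_div_two, sin_sub_pi_div_two, cos_add_pi_div_two,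
      sin_add_pi_div_two]
  rw [quadPart, h, secondDeriv, secondDeriv, map_neg, map_neg, neg_apply, neg_neg]

theorem amoebaNorm_one (s α : ℝ) : amoebaNorm s α 1 = nuL1 (s * sin α) := by
  simp [amoebaNorm, linPart, nuL1]

theorem secondDeriv_dirVec {f : Plane → ℝ} {x : Plane} (hf : ContDiffAt ℝ ∞ f x) (φ τ : ℝ) :
    secondDeriv f x (dirVec (τ + φ)) (dirVec (τ + φ))
      = sin τ ^ 2 * secondDeriv f x (dirVec (φ + π / 2)) (dirVec (φ + π / 2))
        + 2 * (sin τ * cos τ) * secondDeriv f x (dirVec (φ + π / 2)) (dirVec φ)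
        + cos τ ^ 2 * secondDeriv f x (dirVec φ) (dirVec φ) := by
  have hsymm : IsSymmSndFDerivAt ℝ f x := hf.isSymmSndFDerivAt (by
    rw [minSmoothness_of_isRCLikeNormedField]
    exact WithTop.coe_le_coe.2 le_top)
  have h : dirVec (τ + φ) = cos τ • dirVec φ + sin τ • dirVec (φ + π / 2) := by
    ext i
    fin_cases i
    · simp [dirVec, cos_add]
      ring
    · simp [dirVec, sin_add]
      ring
  simp only [secondDeriv, h, map_add, map_smul, add_apply, smul_apply, smul_eq_mul]
  rw [hsymm (dirVec φ) (dirVec (φ + π / 2))]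
  change (_ : ℝ) = _
  ring

theorem intervalIntegrable_amoebaIntegrand (s : ℝ) {w : ℝ → ℝ} (hw : Measurable w)
    (hw1 : ∀ θ, |w θ| ≤ 1) (a b : ℝ) : IntervalIntegrable
      (fun θ => deriv nuL1 (s * cos θ) / nuL1 (s * cos θ) ^ 4 * w θ) volume a b := by
  have hν : ∀ x, 1 ≤ nuL1 x := fun x => le_add_of_nonneg_right (abs_nonneg x)
  have hνm : Measurable nuL1 := measurable_id.abs.const_add 1
  have hc : Measurable fun θ => s * cos θ := measurable_cos.const_mul s
  simp only [deriv_nuL1]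
  refine intervalIntegrable_of_bounded (C := 1)
    (((measurable_sign_real.comp hc).div ((hνm.comp hc).pow_const 4)).mul hw) (fun θ => ?_) a b
  have h4 : 1 ≤ nuL1 (s * cos θ) ^ 4 := one_le_pow₀ (hν _)
  change |SignType.sign (s * cos θ) / nuL1 (s * cos θ) ^ 4 * w θ| ≤ 1
  rw [abs_mul, abs_div, abs_of_nonneg (by linarith : 0 ≤ nuL1 (s * cos θ) ^ 4)]
  refine mul_le_one₀ ?_ (abs_nonneg _) (hw1 θ)
  rw [div_le_one (by linarith)]
  exact (abs_sign_le_one _).trans h4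

/-- The asymmetry of the amoeba in terms of the coefficients of the amoeba PDE. -/
theorem integral_normPert_eq {f : Plane → ℝ} {x : Plane} (hf : ContDiffAt ℝ ∞ f x) (s φ α : ℝ) :
    ∫ θ in (0 : ℝ)..π, normPert s α (quadPart f x (φ + α)) (Complex.exp (θ * Complex.I))
        / amoebaNorm s α (Complex.exp (θ * Complex.I)) ^ 2
      = (amoebaJ1 nuL1 s α * secondDeriv f x (dirVec (φ + π / 2)) (dirVec (φ + π / 2))
        + 2 * amoebaJ2 nuL1 s α * secondDeriv f x (dirVec (φ + π / 2)) (dirVec φ)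
        + amoebaJ3 nuL1 s α * secondDeriv f x (dirVec φ) (dirVec φ)) / 2 := by
  set a := secondDeriv f x (dirVec (φ + π / 2)) (dirVec (φ + π / 2)) with ha
  set b := secondDeriv f x (dirVec (φ + π / 2)) (dirVec φ) with hb
  set c := secondDeriv f x (dirVec φ) (dirVec φ) with hc
  set g : ℝ → ℝ := fun τ => deriv nuL1 (s * cos τ) / nuL1 (s * cos τ) ^ 4 with hg
  -- The shifted angle is measured from ∇f. Of the fourth power of ν, two factors come from
  -- `normPert` and two from the area element in polar coordinates.
  have hpt : ∀ θ : ℝ, normPert s α (quadPart f x (φ + α)) (Complex.exp (θ * Complex.I))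
      / amoebaNorm s α (Complex.exp (θ * Complex.I)) ^ 2
      = (fun τ => g τ * sin τ ^ 2 * (a / 2) + g τ * (sin τ * cos τ) * b
        + g τ * cos τ ^ 2 * (c / 2)) (θ + (α - π / 2)) := by
    intro θ
    have hlin : linPart s α (Complex.exp (θ * Complex.I)) = s * cos (θ + (α - π / 2)) := by
      rw [linPart, Complex.exp_ofReal_mul_I_re, Complex.exp_ofReal_mul_I_im, ← add_sub_assoc,
        cos_sub_pi_div_two, sin_add]
      ring
    have hnorm : amoebaNorm s α (Complex.exp (θ * Complex.I))
        = nuL1 (s * cos (θ + (α - π / 2))) := by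
      rw [amoebaNorm, hlin, Complex.norm_exp_ofReal_mul_I, nuL1]
    have hquad : quadPart f x (φ + α) (Complex.exp (θ * Complex.I))
        = secondDeriv f x (dirVec (θ + (α - π / 2) + φ)) (dirVec (θ + (α - π / 2) + φ)) / 2 := by
      rw [quadPart, planeIso_exp]
      ring_nf
    rw [normPert, hlin, hnorm, hquad, secondDeriv_dirVec hf, ← ha, ← hb, ← hc]
    simp only [hg, deriv_nuL1]
    have : nuL1 (s * cos (θ + (α - π / 2))) ≠ 0 := by
      rw [nuL1]
      positivity
    field_simp
  have h1 := intervalIntegrable_amoebaIntegrand s (w := fun θ => sin θ ^ 2) (by fun_prop)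
    (fun θ => by rw [abs_of_nonneg (sq_nonneg _)]; exact sin_sq_le_one θ) (α - π / 2) (α + π / 2)
  have h2 := intervalIntegrable_amoebaIntegrand s (w := fun θ => sin θ * cos θ) (by fun_prop)
    (fun θ => by
      rw [abs_mul]
      exact mul_le_one₀ (abs_sin_le_one θ) (abs_nonneg _) (abs_cos_le_one θ))
    (α - π / 2) (α + π / 2)
  have h3 := intervalIntegrable_amoebaIntegrand s (w := fun θ => cos θ ^ 2) (by fun_prop)
    (fun θ => by rw [abs_of_nonneg (sq_nonneg _)]; exact cos_sq_le_one θ) (α - π / 2) (α + π / 2)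
  simp only [hpt]
  rw [intervalIntegral.integral_comp_add_right (fun τ => g τ * sin τ ^ 2 * (a / 2)
      + g τ * (sin τ * cos τ) * b + g τ * cos τ ^ 2 * (c / 2)),
    show 0 + (α - π / 2) = α - π / 2 by ring, show π + (α - π / 2) = α + π / 2 by ring,
    intervalIntegral.integral_add ((h1.mul_const _).add (h2.mul_const _)) (h3.mul_const _),
    intervalIntegral.integral_add (h1.mul_const _) (h2.mul_const _),
    intervalIntegral.integral_mul_const, intervalIntegral.integral_mul_const,
    intervalIntegral.integral_mul_const, amoebaJ1, amoebaJ2, amoebaJ3]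
  ring

/-! ### From the area balance to the median. -/

/-- If at least half of `A ⊆ S` has `V > 0`, then the area balance of `V` on `S` is nonnegative, up
to the area of `S \ A`. -/
theorem neg_le_area_balance {F V : ℂ → ℝ} {A : Set ℂ} {ε : ℝ}
    (hA : A ⊆ {z | ‖z‖ + |F z| ≤ 1})
    (hε : volume.real ({z | ‖z‖ + |F z| ≤ 1} \ A) ≤ ε)
    (hmed : volume.real {z ∈ A | V z ≤ 0} ≤ volume.real A / 2) :
    -ε ≤ volume.real {z | ‖z‖ + |F z| ≤ 1 ∧ 0 < V z}
      - volume.real {z | ‖z‖ + |F z| ≤ 1 ∧ V z < 0} := by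
  have hfin : ∀ S ⊆ {z | ‖z‖ + |F z| ≤ 1}, volume S ≠ ⊤ := fun S hS => volume_amoeba_ne_top hS
  -- Only subadditivity is used, since `A` may fail to be measurable.
  have h1 : volume.real A ≤ volume.real {z ∈ A | V z ≤ 0}
      + volume.real {z | ‖z‖ + |F z| ≤ 1 ∧ 0 < V z} := by
    refine (measureReal_mono (fun z hz => ?_) ?_).trans (measureReal_union_le _ _)
    · rcases le_or_gt (V z) 0 with h | h
      · exact Or.inl ⟨hz, h⟩
      · exact Or.inr ⟨hA hz, h⟩
    · exact hfin _ (union_subset (fun z hz => hA hz.1) fun z hz => hz.1)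
  have h2 : volume.real {z | ‖z‖ + |F z| ≤ 1 ∧ V z < 0} ≤ volume.real {z ∈ A | V z ≤ 0}
      + volume.real ({z | ‖z‖ + |F z| ≤ 1} \ A) := by
    refine (measureReal_mono (fun z hz => ?_) ?_).trans (measureReal_union_le _ _)
    · by_cases h : z ∈ A
      · exact Or.inl ⟨h, hz.2.le⟩
      · exact Or.inr ⟨hz.1, h⟩
    · exact hfin _ (union_subset (fun z hz => hA hz.1) fun z hz => hz.1)
  linarith

theorem measureReal_rescaled_le_half {ψ ρ : ℝ} {x : Plane} (hρ : 0 < ρ) {X A : Set Plane}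
    (h : volume X ≤ volume A / 2) (hA : volume A ≠ ⊤) :
    volume.real {z | x + ρ • planeIso ψ z ∈ X}
      ≤ volume.real {z | x + ρ • planeIso ψ z ∈ A} / 2 := by
  have hc0 : ENNReal.ofReal (ρ ^ 2) ≠ 0 := by
    rw [Ne, ENNReal.ofReal_eq_zero, not_le]
    positivity
  rw [volume_eq_rescaled ψ x hρ A] at hA
  have hAfin : volume {z | x + ρ • planeIso ψ z ∈ A} ≠ ⊤ := fun h => by
    rw [h, ENNReal.mul_top hc0] at hA
    exact hA rfl
  rw [volume_eq_rescaled ψ x hρ X, volume_eq_rescaled ψ x hρ A, mul_div_assoc,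
    ENNReal.mul_le_mul_iff_right hc0 ENNReal.ofReal_ne_top] at h
  have := ENNReal.toReal_mono (ENNReal.div_ne_top hAfin two_ne_zero) h
  rwa [ENNReal.toReal_div] at this

/-- After rescaling, the exceptional alternative of `mem_amoeba_or` confines missing points to a
strip and a band, both of width O(ρ), that cross transversally; hence the area O(ρ²). -/
theorem volume_real_amoeba_defect_le {Ω : Set Plane} {f : Plane → ℝ} {x : Plane} {φ α C r ρ : ℝ}
    (hC : 0 ≤ C) (hΩ : Metric.closedBall x r ⊆ Ω) (hgrad : gradient f x ≠ 0)
    (hdir : gradient f x = ‖gradient f x‖ • dirVec φ)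
    (hf : ∀ v, ‖v‖ ≤ r → ContDiffAt ℝ 1 f (x + v) ∧
      ‖fderiv ℝ f (x + v) - fderiv ℝ f x‖ ≤ C * ‖v‖) (hρ : 0 < ρ) (hρr : ρ ≤ r) :
    volume.real ({z | ‖z‖ + |(f (x + ρ • planeIso (φ + α) z) - f x) / ρ| ≤ 1} \
      {z | x + ρ • planeIso (φ + α) z ∈ amoeba nuL1 Ω f ρ x})
      ≤ 8 * (2 * C / ‖gradient f x‖) * (2 * (2 * C) + 2 * C / ‖gradient f x‖) * ρ ^ 2 := by
  set s := ‖gradient f x‖ with hs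
  have hs0 : 0 < s := norm_pos_iff.2 hgrad
  set E := planeIso (φ + α) with hE
  have hsub : {z | ‖z‖ + |(f (x + ρ • E z) - f x) / ρ| ≤ 1} \
      {z | x + ρ • E z ∈ amoeba nuL1 Ω f ρ x} ⊆
      {z | |linPart s α z| ≤ 2 * C * ρ ∧ |amoebaNorm s α z - 1| ≤ 2 * C * ρ} ∪ {0} := by
    rintro z ⟨hz, hnot⟩
    -- The constant curve is not regular, so the segment argument does not cover the centre; a
    -- single point is null anyway.
    rcases eq_or_ne z 0 with h0 | h0
    · exact Or.inr h0
    left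
    have hz' : ‖z‖ + |(f (x + ρ • E z) - f x) / ρ| ≤ 1 := hz
    have hz1 : ‖z‖ ≤ 1 := by linarith [abs_nonneg ((f (x + ρ • E z) - f x) / ρ)]
    have hvn : ‖ρ • E z‖ = ρ * ‖z‖ := by
      rw [norm_smul, norm_eq_abs, abs_of_pos hρ, LinearIsometryEquiv.norm_map]
    have hv0 : ρ • E z ≠ 0 := by
      rw [← norm_ne_zero_iff, hvn]
      exact mul_ne_zero hρ.ne' (norm_ne_zero_iff.2 h0)
    have htn : ∀ t ∈ Icc (0 : ℝ) 1, ‖t • ρ • E z‖ ≤ r := fun t ht => by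
      rw [norm_smul, norm_eq_abs, abs_of_nonneg ht.1, hvn]
      have h1 : ρ * ‖z‖ ≤ ρ := mul_le_of_le_one_right hρ.le hz1
      have h2 : t * (ρ * ‖z‖) ≤ ρ * ‖z‖ := mul_le_of_le_one_left (by positivity) ht.2
      linarith
    have hlen : ‖ρ • E z‖ + |f (x + ρ • E z) - f x| ≤ ρ := by
      rw [abs_div, abs_of_pos hρ] at hz'
      rw [hvn]
      have h1 := mul_le_mul_of_nonneg_left hz' hρ.le
      rwa [mul_add, mul_div_cancel₀ _ hρ.ne', mul_one] at h1
    have hlin : fderiv ℝ f x (ρ • E z) = ρ * linPart s α z := by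
      rw [map_smul, fderiv_planeIso hdir, smul_eq_mul]
    rcases mem_amoeba_or (Ω := Ω) hv0 hC
      (fun t ht => hΩ (by rw [mem_closedBall_iff_norm, add_sub_cancel_left]; exact htn t ht))
      (fun t ht => hf _ (htn t ht)) hlen with h | ⟨h1, h2⟩
    · exact absurd h hnot
    · rw [hlin, hvn, abs_mul, abs_of_pos hρ, mul_pow] at h1
      rw [hvn, mul_pow] at h2
      have hzsq : ‖z‖ ^ 2 ≤ 1 := pow_le_one₀ (norm_nonneg z) hz1
      have hCρ : 0 ≤ C * ρ := by positivity
      have h3 : C * ρ * ‖z‖ ^ 2 ≤ C * ρ := mul_le_of_le_one_right hCρ hzsq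
      have h4 : |linPart s α z| ≤ C * ρ := by
        refine le_trans (le_of_mul_le_mul_left ?_ hρ) h3
        linarith
      have h5 : 1 < ‖z‖ + 2 * C * ρ := by
        refine lt_of_mul_lt_mul_left ?_ hρ.le
        have : ρ * (C * ρ * ‖z‖ ^ 2) ≤ ρ * (C * ρ) := mul_le_mul_of_nonneg_left h3 hρ.le
        linarith
      refine ⟨by linarith, ?_⟩
      rw [amoebaNorm, abs_le]
      have := abs_nonneg (linPart s α z)
      constructor <;> linarith
  refine ENNReal.toReal_le_of_le_ofReal (by positivity) ?_
  refine (measure_mono hsub).trans ((measure_union_le _ _).trans ?_)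
  rw [measure_singleton, add_zero]
  refine (volume_strip_inter_band_le hs0 α (by positivity)).trans (le_of_eq ?_)
  congr 1
  ring

theorem exists_median_amoeba {Ω : Set Plane} {f u : Plane → ℝ} {x : Plane} {r ρ : ℝ}
    (hf : ContDiffOn ℝ ∞ f Ω) (hu : ContinuousOn u (Metric.closedBall x r))
    (hρ : 0 ≤ ρ) (hρr : ρ ≤ r) : volume (amoeba nuL1 Ω f ρ x) ≠ ⊤ ∧
      ∃ m, IsMedianOn u (amoeba nuL1 Ω f ρ x) m := by
  have hsub : amoeba nuL1 Ω f ρ x ⊆ Metric.closedBall x r := fun q hq => by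
    rw [mem_closedBall_iff_norm]
    linarith [norm_add_abs_le_of_mem_amoeba hf hρ hq, abs_nonneg (f q - f x)]
  have hfin : volume (amoeba nuL1 Ω f ρ x) ≠ ⊤ :=
    ((measure_mono hsub).trans_lt measure_closedBall_lt_top).ne
  obtain ⟨M, hM⟩ := (isCompact_closedBall x r).exists_bound_of_continuousOn hu
  refine ⟨hfin, exists_median volume hsub hfin hM fun c => ?_⟩
  classical
  have hm := hu.measurable_piecewise (continuousOn_const (c := c))
    (measurableSet_closedBall (x := x) (ε := r))
  refine (congrArg MeasurableSet (Set.ext fun q => ?_)).mp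
    (measurableSet_lt hm (measurable_const (a := c)))
  by_cases hq : q ∈ Metric.closedBall x r
  · simp only [mem_ofPred_eq, hq, true_and, piecewise_eq_of_mem _ _ _ hq]
  · simp only [mem_ofPred_eq, hq, false_and, piecewise_eq_of_notMem _ _ _ hq, lt_irrefl]

/-- The Taylor expansion in rescaled coordinates. -/
theorem abs_rescaled_sub_le {g : Plane → ℝ} {x : Plane} {ψ C r ρ : ℝ} (hC : 0 ≤ C)
    (hg : ∀ v, ‖v‖ ≤ r →
      |g (x + v) - g x - fderiv ℝ g x v - fderiv ℝ (fderiv ℝ g) x v v / 2| ≤ C * ‖v‖ ^ 3)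
    (hρ : 0 < ρ) (hρr : ρ ≤ r) {z : ℂ} (hz : ‖z‖ ≤ 1) :
    |(g (x + ρ • planeIso ψ z) - g x) / ρ - (fderiv ℝ g x (planeIso ψ z) + ρ * quadPart g x ψ z)|
      ≤ C * ρ ^ 2 := by
  have hvn : ‖ρ • planeIso ψ z‖ = ρ * ‖z‖ := by
    rw [norm_smul, norm_eq_abs, abs_of_pos hρ, LinearIsometryEquiv.norm_map]
  have hvρ : ρ * ‖z‖ ≤ ρ := mul_le_of_le_one_right hρ.le hz
  have h := hg (ρ • planeIso ψ z) (by rw [hvn]; linarith)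
  have e : (g (x + ρ • planeIso ψ z) - g x) / ρ
      - (fderiv ℝ g x (planeIso ψ z) + ρ * quadPart g x ψ z)
      = (g (x + ρ • planeIso ψ z) - g x - fderiv ℝ g x (ρ • planeIso ψ z)
        - fderiv ℝ (fderiv ℝ g) x (ρ • planeIso ψ z) (ρ • planeIso ψ z) / 2) / ρ := by
    rw [quadPart, secondDeriv, map_smul, map_smul, map_smul, smul_apply]
    simp only [smul_eq_mul]
    field_simp
    ring
  rw [e, abs_div, abs_of_pos hρ, div_le_iff₀ hρ]
  refine h.trans ?_
  rw [hvn]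
  calc C * (ρ * ‖z‖) ^ 3 ≤ C * ρ ^ 3 := by gcongr
    _ = C * ρ ^ 2 * ρ := by ring

theorem continuousOn_rescaled {g : Plane → ℝ} {x : Plane} {r ρ : ℝ} (ψ m : ℝ)
    (hg : ContinuousOn g (Metric.closedBall x r)) (hρ : 0 < ρ) (hρr : ρ ≤ r) :
    ContinuousOn (fun z => (g (x + ρ • planeIso ψ z) - m) / ρ) (Metric.closedBall 0 1) := by
  have hmaps : MapsTo (fun z => x + ρ • planeIso ψ z) (Metric.closedBall 0 1)
      (Metric.closedBall x r) := fun z hz => by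
    rw [mem_closedBall_zero_iff] at hz
    rw [mem_closedBall_iff_norm, add_sub_cancel_left, norm_smul, norm_eq_abs, abs_of_pos hρ,
      LinearIsometryEquiv.norm_map]
    exact (mul_le_of_le_one_right hρ.le hz).trans hρr
  have hcont : Continuous fun z => x + ρ • planeIso ψ z :=
    continuous_const.add ((planeIso ψ).continuous.const_smul ρ)
  exact ((hg.comp hcont.continuousOn hmaps).sub continuousOn_const).div_const ρ

/-- If m exceeded the predicted value by more than Dρ³, then at the intermediate level with k = k₀ +
Dρ the balance would be too negative for a set whose part below m is at most half. The lower bound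
is the same argument for −V. -/
theorem amoeba_median_expansion {Ω : Set Plane} {f u : Plane → ℝ} {x₀ : Plane} {φ α : ℝ}
    (hf : ContDiffOn ℝ ∞ f Ω) (hu : ContDiffOn ℝ ∞ u Ω) (hx : x₀ ∈ interior Ω)
    (hgf : gradient f x₀ ≠ 0) (hgu : gradient u x₀ ≠ 0)
    (hφ : gradient f x₀ = ‖gradient f x₀‖ • dirVec φ)
    (hφα : gradient u x₀ = ‖gradient u x₀‖ • dirVec (φ + α)) :
    ∃ C ρ₀ : ℝ, 0 < ρ₀ ∧ ∀ ρ : ℝ, 0 < ρ → ρ < ρ₀ →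
      (∃ m : ℝ, IsMedianOn u (amoeba nuL1 Ω f ρ x₀) m) ∧
      ∀ m : ℝ, IsMedianOn u (amoeba nuL1 Ω f ρ x₀) m →
        |m - (u x₀ + ρ ^ 2 / 6 *
          amoebaPDERhs nuL1 (amoebaJ1 nuL1) (amoebaJ2 nuL1) (amoebaJ3 nuL1) f u φ α x₀)|
          ≤ C * ρ ^ 3 := by
  have hnhds : Ω ∈ 𝓝 x₀ := mem_interior_iff_mem_nhds.1 hx
  have hfx : ContDiffAt ℝ ∞ f x₀ := hf.contDiffAt hnhds
  have hux : ContDiffAt ℝ ∞ u x₀ := hu.contDiffAt hnhds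
  obtain ⟨Cf, rf, hCf, hrf, hTf⟩ := exists_taylor_two_bound hfx
  obtain ⟨Cu, ru, hCu, hru, hTu⟩ := exists_taylor_two_bound hux
  obtain ⟨rΩ, hrΩ, hball⟩ := Metric.nhds_basis_closedBall.mem_iff.1 hnhds
  obtain ⟨r, hr0, hrf', hru', hrΩ'⟩ : ∃ r, 0 < r ∧ r ≤ rf ∧ r ≤ ru ∧ r ≤ rΩ :=
    ⟨min rf (min ru rΩ), by positivity, min_le_left _ _,
      (min_le_right _ _).trans (min_le_left _ _), (min_le_right _ _).trans (min_le_right _ _)⟩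
  have hballr : Metric.closedBall x₀ r ⊆ Ω := (Metric.closedBall_subset_closedBall hrΩ').trans hball
  set s := ‖gradient f x₀‖ with hs
  set w := ‖gradient u x₀‖ with hw
  have hs0 : 0 < s := norm_pos_iff.2 hgf
  have hw0 : 0 < w := norm_pos_iff.2 hgu
  set P := amoebaPDERhs nuL1 (amoebaJ1 nuL1) (amoebaJ2 nuL1) (amoebaJ3 nuL1) f u φ α x₀ with hP
  set k₀ := P / 6 with hk₀
  set M := Cf + Cu + 1 with hM
  obtain ⟨C, ρ₁, hC, hρ₁, hbal⟩ := exists_area_balance_le (α := α) (M := M) (K := |k₀| + 1)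
    (L := ‖fderiv ℝ (fderiv ℝ u) x₀‖) hs0
    (continuous_quadPart f x₀ (φ + α)).measurable (quadPart_smul f x₀ (φ + α))
    (abs_quadPart_le f x₀ (φ + α)) (by positivity) hw0 (continuous_quadPart u x₀ (φ + α))
    (quadPart_smul u x₀ (φ + α)) (abs_quadPart_le u x₀ (φ + α)) (ContinuousLinearMap.opNorm_nonneg _)
    (fun z hz => abs_quadPart_sub_le u x₀ (φ + α) hz) (by positivity)
  set N := amoebaNorm s α 1 with hN
  have hN1 : 1 ≤ N := one_le_amoebaNorm_one s α
  have hN0 : 0 < N := by linarith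
  set c := 4 / (N * w) with hc
  have hc0 : 0 < c := by positivity
  have hlead : ∀ k, 4 * ((1 / N) ^ 3 * quadPart u x₀ (φ + α) 1 / 3 - 1 / N * k) / w
      - 2 * ∫ θ in (0 : ℝ)..π, normPert s α (quadPart f x₀ (φ + α)) (Complex.exp (θ * Complex.I))
        / amoebaNorm s α (Complex.exp (θ * Complex.I)) ^ 2 = c * (k₀ - k) := by
    intro k
    rw [integral_normPert_eq hfx, quadPart_one, hc, hk₀, hP, amoebaPDERhs, ← hs, ← hw,
      ← amoebaNorm_one, ← hN]
    field_simp
    ring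
  simp only [hlead] at hbal
  set C' := 8 * (2 * Cf / s) * (2 * (2 * Cf) + 2 * Cf / s) with hC'
  have hC'0 : 0 ≤ C' := by positivity
  -- A shift of k by Dρ moves the balance by (C + C' + 1)ρ², more than the expansion error Cρ² and
  -- the amoeba defect C'ρ² together.
  set D := (C + C' + 1) / c with hD
  have hD0 : 0 ≤ D := by positivity
  have hcD : c * D = C + C' + 1 := by
    rw [hD]
    field_simp
  -- The bound 1 / (D + 1) gives Dρ ≤ 1, so the shifted levels stay in the range |k| ≤ |k₀| + 1
  -- where the expansion is uniform.
  refine ⟨D, min r (min ρ₁ (1 / (D + 1))), by positivity, fun ρ hρ hρlt => ?_⟩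
  have hρr : ρ ≤ r := hρlt.le.trans (min_le_left _ _)
  have hρρ₁ : ρ ≤ ρ₁ := hρlt.le.trans ((min_le_right _ _).trans (min_le_left _ _))
  have hρD : D * ρ ≤ 1 := by
    have h := hρlt.le.trans ((min_le_right _ _).trans (min_le_right _ _))
    rw [le_div_iff₀ (by positivity)] at h
    linarith
  have hfc : ContinuousOn f (Metric.closedBall x₀ r) := hf.continuousOn.mono hballr
  have huc : ContinuousOn u (Metric.closedBall x₀ r) := hu.continuousOn.mono hballr
  obtain ⟨hAfin, hex⟩ := exists_median_amoeba hf huc hρ.le hρr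
  refine ⟨hex, fun m hm => ?_⟩
  set E := planeIso (φ + α) with hE
  set F : ℂ → ℝ := fun z => (f (x₀ + ρ • E z) - f x₀) / ρ with hF
  set A : Set ℂ := {z | x₀ + ρ • E z ∈ amoeba nuL1 Ω f ρ x₀} with hA
  have hAS : A ⊆ {z | ‖z‖ + |F z| ≤ 1} := by
    intro z hz
    have h := norm_add_abs_le_of_mem_amoeba hf hρ.le hz
    rw [add_sub_cancel_left, norm_smul, norm_eq_abs, abs_of_pos hρ,
      LinearIsometryEquiv.norm_map] at h
    change ‖z‖ + |(f (x₀ + ρ • E z) - f x₀) / ρ| ≤ 1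
    rw [abs_div, abs_of_pos hρ, ← le_sub_iff_add_le', div_le_iff₀ hρ]
    linarith
  have hdefect : volume.real ({z | ‖z‖ + |F z| ≤ 1} \ A) ≤ C' * ρ ^ 2 :=
    volume_real_amoeba_defect_le hCf hballr hgf hφ
      (fun v hv => ⟨(hTf v (hv.trans hrf')).1, (hTf v (hv.trans hrf')).2.1⟩) hρ hρr
  have hFc : ContinuousOn F (Metric.closedBall 0 1) := continuousOn_rescaled (φ + α) _ hfc hρ hρr
  have hFapprox : ∀ z : ℂ, ‖z‖ ≤ 1 →
      |F z - (linPart s α z + ρ * quadPart f x₀ (φ + α) z)| ≤ M * ρ ^ 2 := by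
    intro z hz
    have h := abs_rescaled_sub_le (ψ := φ + α) hCf (fun v hv => (hTf v (hv.trans hrf')).2.2) hρ
      hρr hz
    rw [fderiv_planeIso hφ] at h
    refine h.trans ?_
    gcongr
    linarith
  set V : ℝ → ℂ → ℝ := fun k z => (u (x₀ + ρ • E z) - (u x₀ + ρ ^ 2 * k)) / ρ with hV
  have hVc : ∀ k, ContinuousOn (V k) (Metric.closedBall 0 1) := fun k =>
    continuousOn_rescaled (φ + α) _ huc hρ hρr
  have hfderivu : ∀ z : ℂ, fderiv ℝ u x₀ (E z) = w * z.im := fun z => by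
    have h := fderiv_planeIso (f := u) (x := x₀) (φ := φ + α) hφα 0 z
    rw [add_zero, linPart, cos_zero, sin_zero] at h
    rw [hE, h, hw]
    ring
  have hVapprox : ∀ k, ∀ z : ℂ, ‖z‖ ≤ 1 →
      |V k z - (w * z.im + ρ * (quadPart u x₀ (φ + α) z - k))| ≤ M * ρ ^ 2 := by
    intro k z hz
    have h := abs_rescaled_sub_le (ψ := φ + α) hCu (fun v hv => (hTu v (hv.trans hru')).2.2) hρ
      hρr hz
    rw [← hE, hfderivu] at h
    have e : V k z - (w * z.im + ρ * (quadPart u x₀ (φ + α) z - k))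
        = (u (x₀ + ρ • E z) - u x₀) / ρ - (w * z.im + ρ * quadPart u x₀ (φ + α) z) := by
      simp only [hV]
      field_simp
      ring
    rw [e]
    refine h.trans ?_
    gcongr
    linarith
  have hbalk : ∀ k, |k| ≤ |k₀| + 1 →
      |volume.real {z | ‖z‖ + |F z| ≤ 1 ∧ 0 < V k z} - volume.real {z | ‖z‖ + |F z| ≤ 1 ∧ V k z < 0}
        - ρ * (c * (k₀ - k))| ≤ C * ρ ^ 2 := fun k hk =>
    hbal ρ k F (V k) hρ hρρ₁ hk
      (measurableSet_sublevel_inter_of_continuousOn hFc (hVc k) measurableSet_Ioi)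
      (measurableSet_sublevel_inter_of_continuousOn hFc (hVc k) measurableSet_Iio)
      hFapprox (hVapprox k)
  have hDρ0 : 0 ≤ D * ρ := by positivity
  have hρ2 : 0 < ρ ^ 2 := by positivity
  have hAmeas : volume A ≠ ⊤ := volume_amoeba_ne_top hAS
  have hP6 : ρ ^ 2 / 6 * P = ρ ^ 2 * k₀ := by
    rw [hk₀]
    ring
  rw [hP6]
  by_contra! hcon
  rcases lt_abs.1 hcon with h | h
  · have hk : |k₀ + D * ρ| ≤ |k₀| + 1 := (abs_add_le _ _).trans (by
      rw [abs_of_nonneg hDρ0]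
      linarith)
    have h1 := (abs_le.1 (hbalk _ hk)).2
    have hmed : volume.real {z ∈ A | V (k₀ + D * ρ) z ≤ 0} ≤ volume.real A / 2 := by
      -- The level k₀ + Dρ lies strictly below m, so even V ≤ 0 implies u < m.
      refine le_trans (measureReal_mono (fun z hz => ?_) ?_)
        (measureReal_rescaled_le_half (ψ := φ + α) (x := x₀) hρ hm.1 hAfin)
      · refine ⟨hz.1, ?_⟩
        have h2 : (u (x₀ + ρ • E z) - (u x₀ + ρ ^ 2 * (k₀ + D * ρ))) / ρ ≤ 0 := hz.2
        rw [div_le_iff₀ hρ, zero_mul] at h2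
        change u (x₀ + ρ • E z) < m
        linarith
      · exact measure_ne_top_of_subset (fun z hz => hz.1) hAmeas
    have h2 := neg_le_area_balance hAS hdefect hmed
    have h3 : ρ * (c * (k₀ - (k₀ + D * ρ))) = -(C + C' + 1) * ρ ^ 2 := by
      rw [← hcD]
      ring
    rw [h3] at h1
    linarith
  · have hk : |k₀ - D * ρ| ≤ |k₀| + 1 := (abs_sub _ _).trans (by
      rw [abs_of_nonneg hDρ0]
      linarith)
    have h1 := (abs_le.1 (hbalk _ hk)).1
    have hmed : volume.real {z ∈ A | -V (k₀ - D * ρ) z ≤ 0} ≤ volume.real A / 2 := by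
      refine le_trans (measureReal_mono (fun z hz => ?_) ?_)
        (measureReal_rescaled_le_half (ψ := φ + α) (x := x₀) hρ hm.2 hAfin)
      · refine ⟨hz.1, ?_⟩
        have h2 : 0 ≤ (u (x₀ + ρ • E z) - (u x₀ + ρ ^ 2 * (k₀ - D * ρ))) / ρ := by
          have : -V (k₀ - D * ρ) z ≤ 0 := hz.2
          linarith
        rw [le_div_iff₀ hρ, zero_mul] at h2
        change m < u (x₀ + ρ • E z)
        linarith
      · exact measure_ne_top_of_subset (fun z hz => hz.1) hAmeas
    have h2 := neg_le_area_balance (V := fun z => -V (k₀ - D * ρ) z) hAS hdefect hmed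
    simp only [neg_pos, neg_lt_zero] at h2
    have h3 : ρ * (c * (k₀ - (k₀ - D * ρ))) = (C + C' + 1) * ρ ^ 2 := by
      rw [← hcD]
      ring
    rw [h3] at h1
    linarith

theorem corollary2 :
    -- one amoeba median filtering step is a time step of size `ρ² / 6` for the explicit PDE
    (∀ (Ω : Set Plane) (f u : Plane → ℝ) (x₀ : Plane) (φ α : ℝ),
      ContDiffOn ℝ ∞ f Ω → ContDiffOn ℝ ∞ u Ω → x₀ ∈ interior Ω →
      gradient f x₀ ≠ 0 → gradient u x₀ ≠ 0 →
      gradient f x₀ = ‖gradient f x₀‖ • dirVec φ →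
      gradient u x₀ = ‖gradient u x₀‖ • dirVec (φ + α) →
      ∃ C ρ₀ : ℝ, 0 < ρ₀ ∧ ∀ ρ : ℝ, 0 < ρ → ρ < ρ₀ →
        (∃ m : ℝ, IsMedianOn u (amoeba nuL1 Ω f ρ x₀) m) ∧
        ∀ m : ℝ, IsMedianOn u (amoeba nuL1 Ω f ρ x₀) m →
          |m - (u x₀ + ρ ^ 2 / 6 *
            amoebaPDERhs nuL1 closedJ1 closedJ2 closedJ3 f u φ α x₀)| ≤ C * ρ ^ 3) ∧
    -- the closed forms are the coefficients `J₁`, `J₂`, `J₃` of the amoeba PDE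
    (∀ s α : ℝ, 0 < s →
      amoebaJ1 nuL1 s α = closedJ1 s α ∧
      amoebaJ2 nuL1 s α = closedJ2 s α ∧
      amoebaJ3 nuL1 s α = closedJ3 s α) ∧
    -- at `s = 0`, where `ν'(0)` does not exist, the coefficients are limits for `s → 0+`
    (∀ α : ℝ,
      Tendsto (fun s => amoebaJ1 nuL1 s α) (𝓝[>] 0) (𝓝 (closedJ1 0 α)) ∧
      Tendsto (fun s => amoebaJ2 nuL1 s α) (𝓝[>] 0) (𝓝 (closedJ2 0 α)) ∧
      Tendsto (fun s => amoebaJ3 nuL1 s α) (𝓝[>] 0) (𝓝 (closedJ3 0 α))) := by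
  refine ⟨fun Ω f u x₀ φ α hf hu hx hgf hgu hφ hφα => ?_, fun s α hs => ⟨amoebaJ1_eq_closedJ1 hs α,
    amoebaJ2_eq_closedJ2 hs α, amoebaJ3_eq_closedJ3 hs α⟩, fun α => ⟨tendsto_amoebaJ1_zero α,
    tendsto_amoebaJ2_zero α, tendsto_amoebaJ3_zero α⟩⟩
  have h := amoeba_median_expansion hf hu hx hgf hgu hφ hφα
  -- A nonzero gradient puts s in the range of the closed forms; the limits at s = 0 are not needed
  -- for the expansion.
  have hs : 0 < ‖gradient f x₀‖ := norm_pos_iff.2 hgf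
  simpa only [amoebaPDERhs, amoebaJ1_eq_closedJ1 hs, amoebaJ2_eq_closedJ2 hs,
    amoebaJ3_eq_closedJ3 hs] using h
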